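/- Let $n\ge 1$ and $1<p<\infty$, $p'=p/(p-1)$. A dyadic grid $\mathcal D$ on $\mathbb R^n$ is a collection of half-open cubes of side lengths $2^k$, $k\in\mathbb Z$, such that for each $k$ the cubes of side length $2^k$ partition $\mathbb R^n$ and any two cubes of $\mathcal D$ are nested or disjoint. Write $\langle f\rangle_Q=\frac1{|Q|}\int_Q f\,dx$ and $(f,g)=\int fg\,dx$. For an interval $I$ with right half $I_+$ and left half $I_-$ let $h_I^0=|I|^{-1/2}(\mathbf 1_{I_+}-\mathbf 1_{I_-})$ and $h_I^1=|I|^{-1/2}\mathbf 1_I$; for a cube $Q=I_1\times\dots\times I_n$ and $\epsilon\in\{0,1\}^n$ let $h_Q^\epsilon(x)=\prod_{k}h_{I_k}^{\epsilon_k}(x_k)$, which is cancellative if $\epsilon\not\equiv1$. For signatures $\epsilon,\eta$ let $(\epsilon+\eta)_k=1$ if $\epsilon_k=\eta_k$ and $0$ otherwise, so that $h_Q^\epsilon h_Q^\eta=|Q|^{-1/2}h_Q^{\epsilon+\eta}$. A weight is a locally integrable, a.e. positive function $w$; $w(Q)=\int_Q w\,dx$, $L^p(w)=L^p(w\,dx)$,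 $w'=w^{1-p'}$, and $w\in A_p^{\mathcal D}$ means $$[w]_{A_p}:=\sup_{Q\in\mathcal D}\langle w\rangle_Q\langle w'\rangle_Q^{p-1}<\infty .$$ For a weight $w$, $b\in BMO^{\mathcal D}(w)$ means that $b$ is locally integrable and $\|b\|_{BMO^{\mathcal D}(w)}:=\sup_{Q\in\mathcal D}\frac1{w(Q)}\int_Q|b-\langle b\rangle_Q|\,dx<\infty$. The paraproducts with symbol $b$ are $$\Pi_bf=\sum_{Q\in\mathcal D}\sum_{\epsilon\not\equiv1}(b,h_Q^\epsilon)\langle f\rangle_Qh_Q^\epsilon,\qquad \Pi_b^*f=\sum_{Q\in\mathcal D}\sum_{\epsilon\not\equiv1}(b,h_Q^\epsilon)(f,h_Q^\epsilon)\frac{\mathbf 1_Q}{|Q|},$$ $$\Gamma_bf=\sum_{Q\in\mathcal D}\ \sum_{\epsilon,\eta\not\equiv1,\ \epsilon\ne\eta}(b,h_Q^\epsilon)(f,h_Q^\eta)\frac1{\sqrt{|Q|}}h_Q^{\epsilon+\eta}.$$ **Theorem.** There is a constant $C(n,p)$, depending only on $n$ and $p$, such that for every dyadic grid $\mathcal D$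 on $\mathbb R^n$, all weights $\mu,\lambda\in A_p^{\mathcal D}$ with $\nu:=\mu^{1/p}\lambda^{-1/p}$, and all $b\in BMO^{\mathcal D}(\nu)$, the following holds. For every $f\in L^p(\mu)$ the series (over $Q\in\mathcal D$) defining $\Pi_bf$ converges unconditionally in $L^p(\lambda)$, and $$\|\Pi_b:L^p(\mu)\to L^p(\lambda)\|\le C(n,p)\,\|b\|_{BMO^{\mathcal D}(\nu)}\,[\mu]_{A_p}^{\frac1{p-1}}\,[\lambda]_{A_p}.$$ The same holds for $\Pi_b^*$ and $\Gamma_b$. -/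

import Mathlib

open MeasureTheory Filter Topology
open scoped ENNReal NNReal

noncomputable section

namespace Bloom

/-- A half-open cube `∏ᵢ [aᵢ, aᵢ + 2 ^ k)` in `ℝⁿ`, given by its corner `a` and its scale `k`. -/
structure Cube (n : ℕ) where
  corner : Fin n → ℝ
  scale : ℤ

/-- The side length `2 ^ k`. -/
def Cube.side {n : ℕ} (Q : Cube n) : ℝ := (2 : ℝ) ^ Q.scale

/-- The point set of the cube. -/
def Cube.toSet {n : ℕ} (Q : Cube n) : Set (Fin n → ℝ) :=
  Set.univ.pi fun i => Set.Ico (Q.corner i) (Q.corner i + Q.side)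

/-- The Lebesgue measure `|Q|`. -/
def Cube.vol {n : ℕ} (Q : Cube n) : ℝ := volume.real Q.toSet

/-- A dyadic grid on `ℝⁿ`: a collection of cubes with side lengths `2 ^ k`, `k ∈ ℤ`, such that the
cubes of each fixed side length partition `ℝⁿ`, and any two cubes are nested or disjoint. -/
structure DyadicGrid (n : ℕ) where
  cubes : Set (Cube n)
  partition : ∀ (k : ℤ) (x : Fin n → ℝ), ∃! Q : Cube n, Q ∈ cubes ∧ Q.scale = k ∧ x ∈ Q.toSet
  nested : ∀ P ∈ cubes, ∀ Q ∈ cubes,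
    P.toSet ∩ Q.toSet = P.toSet ∨ P.toSet ∩ Q.toSet = Q.toSet ∨ P.toSet ∩ Q.toSet = ∅

/-- The average `⟨f⟩_Q` with respect to Lebesgue measure. -/
def avg {n : ℕ} (f : (Fin n → ℝ) → ℝ) (Q : Cube n) : ℝ := ⨍ x in Q.toSet, f x

/-! ### Haar functions -/

/-- The one-dimensional Haar functions of the interval `I = [a, a + ℓ)`: for `e = false`
(signature `0`) the cancellative one `|I| ^ (-1/2) (1_{I₊} - 1_{I₋})`, with `I₊` the right half and
`I₋` the left half, and for `e = true` (signature `1`) the non-cancellative one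
`|I| ^ (-1/2) 1_I`. -/
def haarInterval (a l : ℝ) : Bool → ℝ → ℝ
  | false, t => (√l)⁻¹ * ((Set.Ico (a + l / 2) (a + l)).indicator (fun _ => (1 : ℝ)) t
      - (Set.Ico a (a + l / 2)).indicator (fun _ => (1 : ℝ)) t)
  | true, t => (√l)⁻¹ * (Set.Ico a (a + l)).indicator (fun _ => (1 : ℝ)) t

/-- The Haar function `h_Q^ε`, a product of one-dimensional Haar functions. -/
def haar {n : ℕ} (Q : Cube n) (ε : Fin n → Bool) (x : Fin n → ℝ) : ℝ :=
  ∏ i, haarInterval (Q.corner i) Q.side (ε i) (x i)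

/-- The cancellative signatures: all `ε` except `ε ≡ 1`. -/
def cancellative (n : ℕ) : Finset (Fin n → Bool) :=
  Finset.univ.filter fun ε => ε ≠ fun _ => true

/-- The addition of signatures: `(ε + η)ᵢ` is `1` if `εᵢ = ηᵢ` and `0` otherwise, so that
`h_Q^ε h_Q^η = |Q| ^ (-1/2) h_Q^(ε+η)`. -/
def sigAdd {n : ℕ} (ε η : Fin n → Bool) : Fin n → Bool := fun i => ε i == η i

/-- The Haar coefficient `(f, h_Q^ε)`. -/
def haarCoeff {n : ℕ} (f : (Fin n → ℝ) → ℝ) (Q : Cube n) (ε : Fin n → Bool) : ℝ :=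
  ∫ x, f x * haar Q ε x

/-! ### Weights and weighted BMO -/

/-- A weight: a locally integrable, almost everywhere positive function. -/
def IsWeight {n : ℕ} (w : (Fin n → ℝ) → ℝ) : Prop :=
  LocallyIntegrable w volume ∧ ∀ᵐ x, 0 < w x

/-- The measure `w dx`. -/
def weightMeasure {n : ℕ} (w : (Fin n → ℝ) → ℝ) : Measure (Fin n → ℝ) :=
  volume.withDensity fun x => ENNReal.ofReal (w x)

/-- The conjugate weight `w' = w ^ (1 - p')`, where `1/p + 1/p' = 1`. -/
def conjWeight {n : ℕ} (p : ℝ) (w : (Fin n → ℝ) → ℝ) : (Fin n → ℝ) → ℝ :=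
  fun x => w x ^ (1 - p.conjExponent)

/-- The dyadic `A_p` characteristic `[w]_{A_p} = sup_{Q ∈ D} ⟨w⟩_Q ⟨w'⟩_Q ^ (p - 1)`. -/
def apChar {n : ℕ} (D : DyadicGrid n) (p : ℝ) (w : (Fin n → ℝ) → ℝ) : ℝ≥0∞ :=
  ⨆ Q ∈ D.cubes, (⨍⁻ x in Q.toSet, ENNReal.ofReal (w x) ∂volume) *
    (⨍⁻ x in Q.toSet, ENNReal.ofReal (conjWeight p w x) ∂volume) ^ (p - 1)

/-- `w` is a dyadic `A_p` weight. -/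
def IsApWeight {n : ℕ} (D : DyadicGrid n) (p : ℝ) (w : (Fin n → ℝ) → ℝ) : Prop :=
  IsWeight w ∧ apChar D p w < ∞

/-- The dyadic weighted norm `‖b‖_{BMO^D(w)} = sup_{Q ∈ D} (1 / w(Q)) ∫_Q |b - ⟨b⟩_Q| dx`. -/
def bmoNorm {n : ℕ} (D : DyadicGrid n) (w b : (Fin n → ℝ) → ℝ) : ℝ≥0∞ :=
  ⨆ Q ∈ D.cubes, (∫⁻ x in Q.toSet, ‖b x - avg b Q‖ₑ) / weightMeasure w Q.toSet

/-- `b` belongs to the dyadic weighted space `BMO^D(w)`. -/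
def MemBMO {n : ℕ} (D : DyadicGrid n) (w b : (Fin n → ℝ) → ℝ) : Prop :=
  LocallyIntegrable b volume ∧ bmoNorm D w b < ∞

/-- The intermediary Bloom weight `ν = μ ^ (1/p) λ ^ (-1/p)`. -/
def bloomWeight {n : ℕ} (p : ℝ) (mu lam : (Fin n → ℝ) → ℝ) : (Fin n → ℝ) → ℝ :=
  fun x => mu x ^ (1 / p) * lam x ^ (-(1 / p))

/-! ### Paraproducts -/

/-- The term of `Π_b f` at `Q`: the sum over `ε ≢ 1` of `(b, h_Q^ε) ⟨f⟩_Q h_Q^ε`. -/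
def piTerm {n : ℕ} (b : (Fin n → ℝ) → ℝ) (Q : Cube n) (f : (Fin n → ℝ) → ℝ) :
    (Fin n → ℝ) → ℝ :=
  fun x => ∑ ε ∈ cancellative n, haarCoeff b Q ε * avg f Q * haar Q ε x

/-- The term of `Π_b^* f` at `Q`: the sum over `ε ≢ 1` of `(b, h_Q^ε) (f, h_Q^ε) 1_Q / |Q|`. -/
def piStarTerm {n : ℕ} (b : (Fin n → ℝ) → ℝ) (Q : Cube n) (f : (Fin n → ℝ) → ℝ) :
    (Fin n → ℝ) → ℝ :=
  fun x => ∑ ε ∈ cancellative n,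
    haarCoeff b Q ε * haarCoeff f Q ε * (Q.toSet.indicator (fun _ => (1 : ℝ)) x / Q.vol)

/-- The term of `Γ_b f` at `Q`: the sum over `ε, η ≢ 1`, `ε ≠ η`, of
`(b, h_Q^ε) (f, h_Q^η) |Q| ^ (-1/2) h_Q^(ε+η)`. -/
def gammaTerm {n : ℕ} (b : (Fin n → ℝ) → ℝ) (Q : Cube n) (f : (Fin n → ℝ) → ℝ) :
    (Fin n → ℝ) → ℝ :=
  fun x => ∑ ε ∈ cancellative n, ∑ η ∈ (cancellative n).filter (fun η => ε ≠ η),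
    haarCoeff b Q ε * haarCoeff f Q η * ((√Q.vol)⁻¹ * haar Q (sigAdd ε η) x)

/-- The series `∑_{Q ∈ D} t Q` converges unconditionally in `L^p(w)` to `g`. -/
def HasLpSum {n : ℕ} (D : DyadicGrid n) (p : ℝ) (w : (Fin n → ℝ) → ℝ)
    (t : Cube n → (Fin n → ℝ) → ℝ) (g : (Fin n → ℝ) → ℝ) : Prop :=
  MemLp g (ENNReal.ofReal p) (weightMeasure w) ∧
  Tendsto (fun F : Finset D.cubes =>
      eLpNorm (fun x => ∑ Q ∈ F, t Q x - g x) (ENNReal.ofReal p) (weightMeasure w))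
    atTop (𝓝 0)

/-- The operator `T f = ∑_{Q ∈ D} t Q f` is well defined from `L^p(mu)` to `L^p(lam)`, the series
converging unconditionally in `L^p(lam)` for each `f ∈ L^p(mu)`, and
`‖T : L^p(mu) → L^p(lam)‖ ≤ K`. -/
def SeriesNormLE {n : ℕ} (D : DyadicGrid n) (p : ℝ) (mu lam : (Fin n → ℝ) → ℝ)
    (t : Cube n → ((Fin n → ℝ) → ℝ) → (Fin n → ℝ) → ℝ) (K : ℝ≥0∞) : Prop :=
  ∀ f : (Fin n → ℝ) → ℝ, MemLp f (ENNReal.ofReal p) (weightMeasure mu) →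
    ∃ g : (Fin n → ℝ) → ℝ, HasLpSum D p lam (fun Q => t Q f) g ∧
      eLpNorm g (ENNReal.ofReal p) (weightMeasure lam) ≤
        K * eLpNorm f (ENNReal.ofReal p) (weightMeasure mu)

end Bloom

end

/-!
# Bloom-type bounds for dyadic paraproducts

**Reduction to a positive form.** Paired with a locally integrable `g`, a single term of each of the
three operators is bounded by terms `|(b, h_Q^ε)| |(φ, h_Q^θ)| ⟨|ψ|⟩_Q` with `ε`, `θ` cancellative
and `(φ, ψ)` either `(f, g)` or `(g, f)` (`IsParaproductTerm`, `formTerm`). It therefore suffices to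
bound the sums of these nonnegative terms over finite sets of cubes.

**Sparse domination.** Below a cube `Q₀`, the functions `b - ⟨b⟩_{Q₀}`, `φ`, `ψ` are normalized by
the averages over `Q₀` of their absolute values, and one stops at the maximal cubes on which the sum
of the averages of the normalized functions exceeds `6`. The stopping cubes cover at most half of
`Q₀`. Above them, the square of a Haar coefficient of `b` is at most the increase of the energy
`|Q| (⟨b⟩_Q - ⟨b⟩_{Q₀})²` from `Q` to its children, and similarly for `φ` (`sq_haarCoeff_le`); after
normalization the energies telescope and are bounded by a multiple of `|Q₀|`. So the terms above
the stopping cubes contribute at most a multiple of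
`⟨|φ|⟩_{Q₀} ⟨|ψ|⟩_{Q₀} ∫_{Q₀} |b - ⟨b⟩_{Q₀}|`. Iteration over the stopping cubes gives a sparse sum,
but that sum is never written down: if `H` is a superadditive set function, and the displayed
quantity of each cube `S` is at most `H E` for every `E ⊆ S` with `|S| ≤ 2 |E|`, then the form is at
most a multiple of `H(ℝⁿ)` (`sum_formTerm_le`).

**Weights.** Put `σ = μ'`, `f = f₀ σ`, `g = g₀ λ`. On `E ⊆ S` with `|S| ≤ 2 |E|`, Hölder's inequality
`|E| ≤ μ(E)^{1/p} σ(E)^{1/p'}` and its analogue for `λ` give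
`σ(S) μ(S)^{1/p} / |S| ≲ [μ]^{1/(p-1)} σ(E)^{1/p}` and
`λ(S) λ'(S)^{1/p'} / |S| ≲ [λ] λ(E)^{1/p'}` (`mul_rpow_div_le`, `mul_rpow_div_le'`), while
`ν(S) ≤ μ(S)^{1/p} λ'(S)^{1/p'}`. Hence one can take for `H(E)` the product of
`(∫_E (M_σ f₀)^p dσ)^{1/p}`, `(∫_E (M_λ g₀)^{p'} dλ)^{1/p'}` and the constant of the theorem; `H` is
superadditive by Hölder's inequality. The dyadic maximal function of an arbitrary measure is bounded
on `L^p` of that measure with constant `p'` (`lintegral_maxFun_rpow_le_lintegral_rpow`), and so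
`H(ℝⁿ)` is at most a constant times `‖f‖_{L^p(μ)} ‖g₀‖_{L^{p'}(λ)}`.

**Convergence.** By duality, with `g₀ = T |T|^{p-2}`, all finite sums `T` of the series with signs
are bounded in `L^p(λ)` by the required norm (`eLpNorm_sum_le`). Khintchine's inequality shows that a
series in `L^p` whose signed finite sums are bounded cannot have arbitrarily many disjoint blocks of
norm at least `δ > 0`, so it converges unconditionally (`exists_tendsto_of_signs_bounded`), and the
norm bound passes to the limit.
-/

noncomputable section

namespace Bloom

/-! ### Dyadic cubes -/

section Cubes

variable {n : ℕ}

lemma Cube.side_pos (Q : Cube n) : 0 < Q.side := zpow_pos (by norm_num) _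

lemma Cube.measurableSet (Q : Cube n) : MeasurableSet Q.toSet :=
  MeasurableSet.univ_pi fun _ => measurableSet_Ico

lemma Cube.mem_toSet {Q : Cube n} {x : Fin n → ℝ} :
    x ∈ Q.toSet ↔ ∀ i, Q.corner i ≤ x i ∧ x i < Q.corner i + Q.side := by
  simp [Cube.toSet, Set.mem_pi]

lemma Cube.corner_mem (Q : Cube n) : Q.corner ∈ Q.toSet :=
  Cube.mem_toSet.2 fun i => ⟨le_rfl, by linarith [Q.side_pos]⟩

lemma Cube.volume_toSet (Q : Cube n) : volume Q.toSet = ENNReal.ofReal (Q.side ^ n) := by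
  rw [Cube.toSet, Real.volume_pi_Ico]
  simp [ENNReal.ofReal_pow Q.side_pos.le]

lemma Cube.volume_ne_top (Q : Cube n) : volume Q.toSet ≠ ∞ := by
  rw [Q.volume_toSet]; exact ENNReal.ofReal_ne_top

lemma Cube.vol_eq (Q : Cube n) : Q.vol = Q.side ^ n := by
  rw [Cube.vol, measureReal_def, Q.volume_toSet, ENNReal.toReal_ofReal (pow_nonneg Q.side_pos.le _)]

lemma Cube.vol_pos (Q : Cube n) : 0 < Q.vol := by
  rw [Q.vol_eq]; exact pow_pos Q.side_pos _

lemma Cube.ofReal_vol (Q : Cube n) : ENNReal.ofReal Q.vol = volume Q.toSet := by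
  rw [Q.vol_eq, Q.volume_toSet]

lemma Cube.scale_le_of_subset (hn : 0 < n) {P Q : Cube n} (h : P.toSet ⊆ Q.toSet) :
    P.scale ≤ Q.scale := by
  have h1 : P.vol ≤ Q.vol := measureReal_mono h Q.volume_ne_top
  rw [P.vol_eq, Q.vol_eq, pow_le_pow_iff_left₀ P.side_pos.le Q.side_pos.le hn.ne'] at h1
  exact (zpow_le_zpow_iff_right₀ (by norm_num : (1 : ℝ) < 2)).1 h1

lemma Cube.exists_closedBall (Q : Cube n) : ∃ r, Q.toSet ⊆ Metric.closedBall Q.corner r := by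
  refine ⟨Q.side, fun x hx => ?_⟩
  rw [Cube.mem_toSet] at hx
  rw [Metric.mem_closedBall, dist_pi_le_iff Q.side_pos.le]
  intro i
  rw [Real.dist_eq, abs_le]
  constructor <;> linarith [hx i, Q.side_pos]

/-- A locally integrable function is integrable on each cube. -/
lemma Cube.integrableOn (Q : Cube n) {f : (Fin n → ℝ) → ℝ} (hf : LocallyIntegrable f) :
    IntegrableOn f Q.toSet := by
  obtain ⟨r, hr⟩ := Q.exists_closedBall
  exact (hf.integrableOn_isCompact (isCompact_closedBall _ _)).mono_set hr

/-- The dyadic child of `Q` in the corner given by `ω`: the upper half of the `i`-th side is taken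
when `ω i` is true. -/
def Cube.child (Q : Cube n) (ω : Fin n → Bool) : Cube n :=
  ⟨fun i => Q.corner i + if ω i then Q.side / 2 else 0, Q.scale - 1⟩

lemma Cube.side_child (Q : Cube n) (ω : Fin n → Bool) : (Q.child ω).side = Q.side / 2 := by
  simp [Cube.side, Cube.child, zpow_sub₀]

lemma Cube.vol_child (Q : Cube n) (ω : Fin n → Bool) : (Q.child ω).vol = Q.vol / 2 ^ n := by
  rw [Cube.vol_eq, Cube.vol_eq, Q.side_child, div_pow]

lemma Cube.mem_child {Q : Cube n} {ω : Fin n → Bool} {x : Fin n → ℝ} :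
    x ∈ (Q.child ω).toSet ↔
      x ∈ Q.toSet ∧ ω = fun i => decide (Q.corner i + Q.side / 2 ≤ x i) := by
  have hs := Q.side_pos
  rw [Cube.mem_toSet, Cube.mem_toSet, Q.side_child, funext_iff, ← forall_and]
  refine forall_congr' fun i => ?_
  by_cases h : ω i
  · simp only [Cube.child, h, if_true, eq_comm (a := true), decide_eq_true_eq]
    constructor
    · rintro ⟨h1, h2⟩; refine ⟨⟨?_, ?_⟩, ?_⟩ <;> linarith
    · rintro ⟨⟨h1, h2⟩, h3⟩; constructor <;> linarith
  · rw [Bool.not_eq_true] at h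
    simp only [Cube.child, h, Bool.false_eq_true, if_false, add_zero]
    simp only [Bool.false_eq, decide_eq_false_iff_not, not_le]
    constructor
    · rintro ⟨h1, h2⟩; refine ⟨⟨?_, ?_⟩, ?_⟩ <;> linarith
    · rintro ⟨⟨h1, h2⟩, h3⟩; constructor <;> linarith

lemma Cube.child_subset (Q : Cube n) (ω : Fin n → Bool) : (Q.child ω).toSet ⊆ Q.toSet :=
  fun _ hx => (Cube.mem_child.1 hx).1

lemma Cube.disjoint_child (Q : Cube n) :
    Pairwise (Function.onFun Disjoint fun ω => (Q.child ω).toSet) := by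
  intro ω ω' h
  refine Set.disjoint_left.2 fun x hx hx' => h ?_
  rw [(Cube.mem_child.1 hx).2, (Cube.mem_child.1 hx').2]

lemma Cube.iUnion_child (Q : Cube n) : ⋃ ω, (Q.child ω).toSet = Q.toSet := by
  refine Set.Subset.antisymm (Set.iUnion_subset Q.child_subset) fun x hx => ?_
  exact Set.mem_iUnion.2 ⟨_, Cube.mem_child.2 ⟨hx, rfl⟩⟩

lemma Cube.sum_integral_child (Q : Cube n) {f : (Fin n → ℝ) → ℝ} (hf : LocallyIntegrable f) :
    ∑ ω, ∫ x in (Q.child ω).toSet, f x = ∫ x in Q.toSet, f x := by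
  rw [← Q.iUnion_child, integral_iUnion_fintype (fun ω => (Q.child ω).measurableSet)
    Q.disjoint_child fun ω => (Q.child ω).integrableOn hf]

variable (D : DyadicGrid n)

lemma DyadicGrid.eq_of_mem {P Q : Cube n} (hP : P ∈ D.cubes) (hQ : Q ∈ D.cubes)
    (hs : P.scale = Q.scale) {x : Fin n → ℝ} (hxP : x ∈ P.toSet) (hxQ : x ∈ Q.toSet) : P = Q :=
  (D.partition Q.scale x).unique ⟨hP, hs, hxP⟩ ⟨hQ, rfl, hxQ⟩

lemma DyadicGrid.subset_or_disjoint (hn : 0 < n) {P Q : Cube n} (hP : P ∈ D.cubes)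
    (hQ : Q ∈ D.cubes) (hs : P.scale ≤ Q.scale) :
    P.toSet ⊆ Q.toSet ∨ Disjoint P.toSet Q.toSet := by
  rcases D.nested P hP Q hQ with h | h | h
  · exact .inl (Set.inter_eq_left.1 h)
  · have hQP := Set.inter_eq_right.1 h
    have := D.eq_of_mem hP hQ (hs.antisymm (Cube.scale_le_of_subset hn hQP)) (hQP Q.corner_mem)
      Q.corner_mem
    exact .inl (this ▸ subset_rfl)
  · exact .inr (Set.disjoint_iff_inter_eq_empty.2 h)

/-- The grid contains the children of its cubes. The cube of the grid of half the side length
that contains the corner of the child `ω` is the child itself; this is seen by induction on the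
number of upper halves in `ω`, using the disjointness from the neighbour below. -/
lemma DyadicGrid.child_mem (hn : 0 < n) {Q : Cube n} (hQ : Q ∈ D.cubes) (ω : Fin n → Bool) :
    Q.child ω ∈ D.cubes := by
  have hs := Q.side_pos
  induction hm : (Finset.univ.filter fun i => ω i = true).card using Nat.strong_induction_on
    generalizing ω with
  | _ m ih =>
  obtain ⟨R, ⟨hR, hRs, hxR⟩, -⟩ := D.partition (Q.scale - 1) (Q.child ω).corner
  have hRside : R.side = Q.side / 2 := by rw [← Q.side_child ω, Cube.side, hRs]; rfl
  have hxQ : (Q.child ω).corner ∈ Q.toSet := Q.child_subset ω (Cube.corner_mem _)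
  have hRQ : R.toSet ⊆ Q.toSet := by
    rcases D.subset_or_disjoint hn hR hQ (by omega) with h | h
    · exact h
    · exact absurd hxQ (Set.disjoint_left.1 h hxR)
  have hlow : ∀ i, Q.corner i ≤ R.corner i := fun i => (Cube.mem_toSet.1 (hRQ R.corner_mem) i).1
  have hxR' := Cube.mem_toSet.1 hxR
  suffices h : R.corner = (Q.child ω).corner by
    have : R = Q.child ω := by
      cases R; simp only [Cube.child] at *; simp_all
    exact this ▸ hR
  funext i
  cases hω : ω i with
  | false =>
    have := hxR' i
    simp only [Cube.child, hω, Bool.false_eq_true, if_false, add_zero] at this ⊢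
    exact le_antisymm this.1 (hlow i)
  | true =>
    have hi := hxR' i
    simp only [Cube.child, hω, if_true, hRside] at hi ⊢
    refine le_antisymm hi.1 (not_lt.1 fun hlt => ?_)
    -- `R` would meet the neighbour of the child `ω` below it in the direction `i`
    have hP : Q.child (Function.update ω i false) ∈ D.cubes := by
      refine ih _ ?_ _ rfl
      rw [← hm]
      refine Finset.card_lt_card (Finset.ssubset_iff_of_subset ?_ |>.2 ⟨i, by simp [hω], by simp⟩)
      intro j hj
      by_cases hji : j = i
      · subst hji; simp at hj
      · simpa [Function.update_of_ne hji] using hj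
    have hzR : Function.update (Q.child ω).corner i (R.corner i) ∈ R.toSet := by
      rw [Cube.mem_toSet]; intro j
      by_cases hji : j = i
      · subst hji; simp [R.side_pos]
      · simpa [Function.update_of_ne hji] using hxR' j
    have hzP : Function.update (Q.child ω).corner i (R.corner i) ∈
        (Q.child (Function.update ω i false)).toSet := by
      rw [Cube.mem_toSet, Cube.side_child]; intro j
      by_cases hji : j = i
      · subst hji
        simp only [Function.update_self, Cube.child, Bool.false_eq_true, if_false, add_zero]
        exact ⟨hlow j, hlt⟩
      · simp only [Function.update_of_ne hji, Cube.child]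
        constructor <;> linarith
    have hRP := D.eq_of_mem hR hP hRs hzR hzP
    have : R.corner i = Q.corner i := by rw [hRP]; simp [Cube.child]
    linarith

/-- The cubes of a grid inside one of its cubes and of at least a given side length are finite in
number. -/
lemma DyadicGrid.finite_descendants (hn : 0 < n) {Q : Cube n} (hQ : Q ∈ D.cubes) (s : ℤ) :
    {R | R ∈ D.cubes ∧ R.toSet ⊆ Q.toSet ∧ s ≤ R.scale}.Finite := by
  obtain ⟨N, hN⟩ : ∃ N : ℕ, Q.scale < s + N := ⟨(Q.scale - s + 1).toNat, by omega⟩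
  induction N generalizing Q with
  | zero =>
    convert Set.finite_empty (α := Cube n)
    ext R
    simp only [Set.mem_ofPred_eq, Set.mem_empty_iff_false, iff_false, not_and]
    intro _ h2 h3
    have := Cube.scale_le_of_subset hn h2
    omega
  | succ N ih =>
    refine ((Set.finite_singleton Q).union (Set.finite_iUnion fun ω =>
      ih (D.child_mem hn hQ ω) (by simp only [Cube.child]; omega))).subset ?_
    rintro R ⟨h1, h2, h3⟩
    obtain h | h := eq_or_ne R.scale Q.scale
    · exact .inl (D.eq_of_mem h1 hQ h R.corner_mem (h2 R.corner_mem))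
    · right
      obtain ⟨ω, hω⟩ := Set.mem_iUnion.1 (Q.iUnion_child.symm ▸ h2 R.corner_mem)
      refine Set.mem_iUnion.2 ⟨ω, h1, ?_, h3⟩
      have := Cube.scale_le_of_subset hn h2
      refine (D.subset_or_disjoint hn h1 (D.child_mem hn hQ ω)
        (by simp only [Cube.child]; omega)).resolve_right fun hd => ?_
      exact Set.disjoint_left.1 hd R.corner_mem hω

end Cubes

/-! ### Haar functions on the children of a cube -/

section Haar

variable {n : ℕ}

lemma avg_eq (f : (Fin n → ℝ) → ℝ) (Q : Cube n) : avg f Q = (∫ x in Q.toSet, f x) / Q.vol := by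
  rw [avg, setAverage_eq, smul_eq_mul, Cube.vol, inv_mul_eq_div]

lemma vol_mul_avg (f : (Fin n → ℝ) → ℝ) (Q : Cube n) : Q.vol * avg f Q = ∫ x in Q.toSet, f x := by
  rw [avg_eq, mul_div_cancel₀ _ Q.vol_pos.ne']

lemma locallyIntegrable_abs {f : (Fin n → ℝ) → ℝ} (hf : LocallyIntegrable f) :
    LocallyIntegrable fun x => |f x| := fun x => by
  obtain ⟨s, hs, h⟩ := hf x
  exact ⟨s, hs, h.norm⟩

lemma avg_abs_nonneg (f : (Fin n → ℝ) → ℝ) (Q : Cube n) : 0 ≤ avg (fun x => |f x|) Q := by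
  rw [avg_eq]
  exact div_nonneg (integral_nonneg fun _ => abs_nonneg _) Q.vol_pos.le

lemma abs_avg_le (f : (Fin n → ℝ) → ℝ) (Q : Cube n) : |avg f Q| ≤ avg (fun x => |f x|) Q := by
  rw [avg_eq, avg_eq, abs_div, abs_of_pos Q.vol_pos]
  exact div_le_div_of_nonneg_right (abs_integral_le_integral_abs) Q.vol_pos.le

lemma avg_sub_const {f : (Fin n → ℝ) → ℝ} (hf : LocallyIntegrable f) (c : ℝ) (Q : Cube n) :
    avg (fun x => f x - c) Q = avg f Q - c := by
  have hc : IntegrableOn (fun _ : Fin n → ℝ => c) Q.toSet :=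
    integrableOn_const Q.volume_ne_top
  rw [avg_eq, avg_eq, integral_sub (Q.integrableOn hf) hc, setIntegral_const, sub_div, smul_eq_mul,
    ← Cube.vol, mul_div_cancel_left₀ _ Q.vol_pos.ne']

/-- The sign that `h_Q^ε` takes on the child `ω` of `Q`. -/
def haarSign (ε ω : Fin n → Bool) : ℝ := ∏ i, if ε i = true ∨ ω i = true then 1 else -1

lemma abs_haarSign (ε ω : Fin n → Bool) : |haarSign ε ω| = 1 := by
  rw [haarSign, Finset.abs_prod]
  exact Finset.prod_eq_one fun i _ => by split_ifs <;> simp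

lemma sum_haarSign {ε : Fin n → Bool} (hε : ε ∈ cancellative n) :
    ∑ ω : Fin n → Bool, haarSign ε ω = 0 := by
  obtain ⟨i, hi⟩ : ∃ i, ε i ≠ true := by
    by_contra! h
    exact (Finset.mem_filter.1 hε).2 (funext h)
  unfold haarSign
  rw [← Fintype.prod_sum (fun i (e : Bool) => if ε i = true ∨ e = true then (1 : ℝ) else -1)]
  exact Finset.prod_eq_zero (Finset.mem_univ i) (by simp [hi])

lemma haarInterval_of_mem {a l t : ℝ} (h1 : a ≤ t) (h2 : t < a + l) (e : Bool) :
    haarInterval a l e t =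
      (√l)⁻¹ * if e = true ∨ decide (a + l / 2 ≤ t) = true then 1 else -1 := by
  cases e <;> simp only [haarInterval, Set.indicator, Set.mem_Ico] <;> congr 1
  · by_cases h : a + l / 2 ≤ t
    · simp [h, h2, not_lt.2 h]
    · simp [h, not_le.1 h, h1]
  · simp [h1, h2]

lemma haarInterval_of_notMem {a l t : ℝ} (hl : 0 < l) (h : ¬(a ≤ t ∧ t < a + l)) (e : Bool) :
    haarInterval a l e t = 0 := by
  cases e <;> simp only [haarInterval, Set.indicator, Set.mem_Ico]
  · rw [if_neg (fun h' => h ⟨by linarith, h'.2⟩), if_neg (fun h' => h ⟨h'.1, by linarith⟩)]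
    simp
  · rw [if_neg h]; simp

lemma haar_of_notMem {Q : Cube n} {x : Fin n → ℝ} (h : x ∉ Q.toSet) (ε : Fin n → Bool) :
    haar Q ε x = 0 := by
  rw [Cube.mem_toSet] at h
  push Not at h
  obtain ⟨i, hi⟩ := h
  exact Finset.prod_eq_zero (Finset.mem_univ i)
    (haarInterval_of_notMem Q.side_pos (fun h' => absurd h'.2 (not_lt.2 (hi h'.1))) _)

lemma haar_of_mem_child {Q : Cube n} {ω : Fin n → Bool} {x : Fin n → ℝ}
    (h : x ∈ (Q.child ω).toSet) (ε : Fin n → Bool) :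
    haar Q ε x = (√Q.vol)⁻¹ * haarSign ε ω := by
  obtain ⟨hQ, hω⟩ := Cube.mem_child.1 h
  have hpow : √Q.vol = √Q.side ^ n := by
    rw [Q.vol_eq, Real.sqrt_eq_iff_mul_self_eq (pow_nonneg Q.side_pos.le _) (by positivity),
      ← mul_pow, Real.mul_self_sqrt Q.side_pos.le]
  rw [haar, haarSign, hpow, ← inv_pow, hω]
  rw [Finset.prod_congr rfl fun i _ => haarInterval_of_mem (Cube.mem_toSet.1 hQ i).1
    (Cube.mem_toSet.1 hQ i).2 (ε i), Finset.prod_mul_distrib]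
  simp

lemma haar_eq_sum (Q : Cube n) (ε : Fin n → Bool) (x : Fin n → ℝ) :
    haar Q ε x = ∑ ω, (Q.child ω).toSet.indicator (fun _ => (√Q.vol)⁻¹ * haarSign ε ω) x := by
  by_cases hx : x ∈ Q.toSet
  · obtain ⟨ω, hω⟩ := Set.mem_iUnion.1 (Q.iUnion_child.symm ▸ hx)
    rw [Finset.sum_eq_single ω, Set.indicator_of_mem hω, haar_of_mem_child hω]
    · intro ω' _ hne
      exact Set.indicator_of_notMem (fun h => Set.disjoint_left.1 (Q.disjoint_child hne) h hω) _
    · simp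
  · rw [haar_of_notMem hx, Finset.sum_eq_zero]
    exact fun ω _ => Set.indicator_of_notMem (fun h => hx (Q.child_subset ω h)) _

lemma measurable_haar (Q : Cube n) (ε : Fin n → Bool) : Measurable (haar Q ε) := by
  rw [funext (haar_eq_sum Q ε)]
  exact Finset.measurable_sum _ fun ω _ => measurable_const.indicator (Q.child ω).measurableSet

lemma abs_haar_le (Q : Cube n) (ε : Fin n → Bool) (x : Fin n → ℝ) :
    |haar Q ε x| ≤ Q.toSet.indicator (fun _ => (√Q.vol)⁻¹) x := by
  by_cases hx : x ∈ Q.toSet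
  · obtain ⟨ω, hω⟩ := Set.mem_iUnion.1 (Q.iUnion_child.symm ▸ hx)
    rw [haar_of_mem_child hω, Set.indicator_of_mem hx, abs_mul, abs_haarSign, mul_one,
      abs_of_nonneg (by positivity)]
  · rw [haar_of_notMem hx, Set.indicator_of_notMem hx, abs_zero]

lemma integrable_mul_haar {f : (Fin n → ℝ) → ℝ} (hf : LocallyIntegrable f) (Q : Cube n)
    (ε : Fin n → Bool) : Integrable fun x => f x * haar Q ε x := by
  have h : Integrable (Q.toSet.indicator f) :=
    (integrable_indicator_iff Q.measurableSet).2 (Q.integrableOn hf)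
  refine (h.mul_bdd (c := (√Q.vol)⁻¹) (measurable_haar Q ε).aestronglyMeasurable
    (.of_forall fun x => (abs_haar_le Q ε x).trans ?_)).congr (.of_forall fun x => ?_)
  · exact Set.indicator_le_self' (fun _ _ => by positivity) x
  · by_cases hx : x ∈ Q.toSet
    · simp [hx]
    · simp [hx, haar_of_notMem hx]

lemma haarCoeff_eq_sum {f : (Fin n → ℝ) → ℝ} (hf : LocallyIntegrable f) (Q : Cube n)
    (ε : Fin n → Bool) :
    haarCoeff f Q ε = (√Q.vol)⁻¹ * ∑ ω, haarSign ε ω * ∫ x in (Q.child ω).toSet, f x := by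
  have h (ω : Fin n → Bool) : (fun x => f x *
      (Q.child ω).toSet.indicator (fun _ => (√Q.vol)⁻¹ * haarSign ε ω) x) =
      (Q.child ω).toSet.indicator fun x => f x * ((√Q.vol)⁻¹ * haarSign ε ω) := by
    funext x; by_cases hx : x ∈ (Q.child ω).toSet <;> simp [hx]
  simp only [haarCoeff, haar_eq_sum, Finset.mul_sum]
  rw [integral_finsetSum]
  · refine Finset.sum_congr rfl fun ω _ => ?_
    rw [h, integral_indicator (Q.child ω).measurableSet, integral_mul_const]
    ring
  · intro ω _
    rw [h, integrable_indicator_iff (Q.child ω).measurableSet]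
    exact ((Q.child ω).integrableOn hf).mul_const _

lemma abs_haarCoeff_le {f : (Fin n → ℝ) → ℝ} (hf : LocallyIntegrable f) (Q : Cube n)
    (ε : Fin n → Bool) : |haarCoeff f Q ε| ≤ (√Q.vol)⁻¹ * ∫ x in Q.toSet, |f x| := by
  rw [haarCoeff_eq_sum hf, abs_mul, abs_of_nonneg (a := (√Q.vol)⁻¹) (by positivity)]
  rw [← Q.sum_integral_child (locallyIntegrable_abs hf)]
  refine mul_le_mul_of_nonneg_left ((Finset.abs_sum_le_sum_abs _ _).trans
    (Finset.sum_le_sum fun ω _ => ?_)) (by positivity)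
  rw [abs_mul, abs_haarSign, one_mul]
  exact abs_integral_le_integral_abs

lemma sqrt_inv_mul_abs_haarCoeff_le {f : (Fin n → ℝ) → ℝ} (hf : LocallyIntegrable f) (Q : Cube n)
    (ε : Fin n → Bool) : (√Q.vol)⁻¹ * |haarCoeff f Q ε| ≤ avg (fun x => |f x|) Q := by
  have hV := Q.vol_pos
  refine (mul_le_mul_of_nonneg_left (abs_haarCoeff_le hf Q ε) (by positivity)).trans_eq ?_
  rw [avg_eq, ← mul_assoc, ← mul_inv, Real.mul_self_sqrt hV.le, inv_mul_eq_div]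

lemma avg_eq_sum_child {f : (Fin n → ℝ) → ℝ} (hf : LocallyIntegrable f) (Q : Cube n) :
    avg f Q = (∑ ω, avg f (Q.child ω)) / 2 ^ n := by
  have hV := Q.vol_pos
  rw [avg_eq, ← Q.sum_integral_child hf, Finset.sum_div, Finset.sum_div]
  refine Finset.sum_congr rfl fun ω _ => ?_
  rw [avg_eq, Q.vol_child]
  field_simp

/-- Local Bessel inequality: the square of a cancellative Haar coefficient is at most the increase
of the energy `|Q| (⟨f⟩_Q - c)²` under passage from a cube to its children. -/
lemma sq_haarCoeff_le {f : (Fin n → ℝ) → ℝ} (hf : LocallyIntegrable f) (Q : Cube n)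
    {ε : Fin n → Bool} (hε : ε ∈ cancellative n) (c : ℝ) :
    haarCoeff f Q ε ^ 2 ≤ ∑ ω, (Q.child ω).vol * (avg f (Q.child ω) - c) ^ 2
      - Q.vol * (avg f Q - c) ^ 2 := by
  have hV := Q.vol_pos
  set y : (Fin n → Bool) → ℝ := fun ω => avg f (Q.child ω) with hy
  set m := avg f Q with hm
  have hsum : ∑ ω, y ω = 2 ^ n * m := by
    rw [hm, avg_eq_sum_child hf, mul_div_cancel₀ _ (by positivity)]
  have hcard : ((Finset.univ : Finset (Fin n → Bool)).card : ℝ) = 2 ^ n := by simp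
  have h1 : haarCoeff f Q ε = (√Q.vol)⁻¹ * (Q.vol / 2 ^ n) * ∑ ω, haarSign ε ω * (y ω - m) := by
    simp_rw [mul_sub, Finset.sum_sub_distrib, ← Finset.sum_mul, sum_haarSign hε, zero_mul, sub_zero]
    rw [haarCoeff_eq_sum hf, mul_assoc, Finset.mul_sum (a := Q.vol / 2 ^ n)]
    congr 1
    refine Finset.sum_congr rfl fun ω _ => ?_
    rw [← vol_mul_avg, Q.vol_child]; ring
  have h2 : (∑ ω, haarSign ε ω * (y ω - m)) ^ 2 ≤ 2 ^ n * ∑ ω, (y ω - m) ^ 2 := by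
    rw [← hcard]
    refine sq_sum_le_card_mul_sum_sq.trans_eq ?_
    simp_rw [mul_pow, ← sq_abs (haarSign _ _), abs_haarSign, one_pow, one_mul]
  have h3 : ∑ ω, (y ω - m) ^ 2 = ∑ ω, (y ω - c) ^ 2 - 2 ^ n * (m - c) ^ 2 := by
    have : ∀ ω, (y ω - m) ^ 2 = (y ω - c) ^ 2 - 2 * (m - c) * y ω + (m ^ 2 - c ^ 2) := by
      intro ω; ring
    simp_rw [this, Finset.sum_add_distrib, Finset.sum_sub_distrib, ← Finset.mul_sum, hsum,
      Finset.sum_const, nsmul_eq_mul, hcard]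
    ring
  have hsq : ((√Q.vol)⁻¹) ^ 2 = Q.vol⁻¹ := by rw [inv_pow, Real.sq_sqrt hV.le]
  calc haarCoeff f Q ε ^ 2
      = Q.vol⁻¹ * (Q.vol / 2 ^ n) ^ 2 * (∑ ω, haarSign ε ω * (y ω - m)) ^ 2 := by
        rw [h1, mul_pow, mul_pow, hsq]
    _ ≤ Q.vol⁻¹ * (Q.vol / 2 ^ n) ^ 2 * (2 ^ n * ∑ ω, (y ω - m) ^ 2) :=
        mul_le_mul_of_nonneg_left h2 (by positivity)
    _ = _ := by
        rw [h3]
        simp_rw [Q.vol_child, ← Finset.mul_sum]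
        field_simp
        rfl

end Haar

/-! ### Sparse domination by stopping cubes -/

section SparseDomination

variable {n : ℕ}

open scoped Classical in
/-- The sum of `a` over the cubes of `F` that are contained in `Q`. -/
def sumBelow (F : Finset (Cube n)) (a : Cube n → ℝ) (Q : Cube n) : ℝ :=
  ∑ R ∈ F with R.toSet ⊆ Q.toSet, a R

lemma sumBelow_eq_zero {F : Finset (Cube n)} {a : Cube n → ℝ} {Q : Cube n}
    (h : ∀ R ∈ F, R.toSet ⊆ Q.toSet → a R = 0) : sumBelow F a Q = 0 := by
  classical exact Finset.sum_eq_zero fun R hR => h R (Finset.mem_filter.1 hR).1 (Finset.mem_filter.1 hR).2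

lemma sumBelow_le (hn : 0 < n) (D : DyadicGrid n) {F : Finset (Cube n)}
    (hF : ∀ R ∈ F, R ∈ D.cubes) {a : Cube n → ℝ} (ha : ∀ R, 0 ≤ a R) {Q : Cube n}
    (hQ : Q ∈ D.cubes) :
    sumBelow F a Q ≤ a Q + ∑ ω, sumBelow F a (Q.child ω) := by
  classical
  simp only [sumBelow, Finset.sum_filter]
  rw [Finset.sum_comm]
  have h1 : ∑ R ∈ F, (if R = Q then a R else 0) ≤ a Q := by
    rw [Finset.sum_ite_eq' F Q a]
    split_ifs
    exacts [le_rfl, ha Q]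
  refine le_trans ?_ (add_le_add_left h1 _)
  rw [← Finset.sum_add_distrib]
  refine Finset.sum_le_sum fun R hR => ?_
  have hnn : ∀ ω ∈ (Finset.univ : Finset (Fin n → Bool)),
      0 ≤ if R.toSet ⊆ (Q.child ω).toSet then a R else 0 := fun ω _ => by
    split_ifs
    exacts [ha R, le_rfl]
  split_ifs with h1 h2 h2
  · linarith [Finset.sum_nonneg hnn]
  · obtain ⟨ω, hω⟩ := Set.mem_iUnion.1 (Q.iUnion_child.symm ▸ h1 R.corner_mem)
    have hlt : R.scale < Q.scale := lt_of_le_of_ne (Cube.scale_le_of_subset hn h1) fun h =>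
      h2 (D.eq_of_mem (hF R hR) hQ h R.corner_mem (h1 R.corner_mem))
    have hsub := (D.subset_or_disjoint hn (hF R hR) (D.child_mem hn hQ ω)
      (by simp only [Cube.child]; omega)).resolve_right
        fun hd => Set.disjoint_left.1 hd R.corner_mem hω
    have := Finset.single_le_sum hnn (Finset.mem_univ ω)
    rw [if_pos hsub] at this
    linarith
  · linarith [Finset.sum_nonneg hnn, ha R]
  · linarith [Finset.sum_nonneg hnn]

/-- If `|f| ≤ B w` and the average of `w` over `Q` is at most `6`, then the average of `|f|` over a
subcube `R` of `Q` is at most `6 B |Q| / |R|`. -/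
lemma avg_abs_le_of_le_mul {f w : (Fin n → ℝ) → ℝ} (hf : LocallyIntegrable f)
    (hw : LocallyIntegrable w) {B : ℝ} (hB : 0 < B) (h : ∀ x, |f x| ≤ B * w x) {R Q : Cube n}
    (hRQ : R.toSet ⊆ Q.toSet) (hQ : ∫ x in Q.toSet, w x ≤ 6 * Q.vol) :
    avg (fun x => |f x|) R ≤ 6 * B * (Q.vol / R.vol) := by
  have hw0 : ∀ x, 0 ≤ w x := fun x =>
    nonneg_of_mul_nonneg_right ((abs_nonneg _).trans (h x)) hB
  rw [avg_eq, ← mul_div_assoc]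
  refine div_le_div_of_nonneg_right ?_ R.vol_pos.le
  calc ∫ x in R.toSet, |f x| ≤ ∫ x in R.toSet, B * w x :=
        integral_mono (R.integrableOn (locallyIntegrable_abs hf))
          ((R.integrableOn hw).const_mul B) h
    _ = B * ∫ x in R.toSet, w x := integral_const_mul _ _
    _ ≤ B * ∫ x in Q.toSet, w x := mul_le_mul_of_nonneg_left
        (setIntegral_mono_set (Q.integrableOn hw) (.of_forall hw0) (LE.le.eventuallyLE hRQ))
        hB.le
    _ ≤ B * (6 * Q.vol) := mul_le_mul_of_nonneg_left hQ hB.le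
    _ = _ := by ring

/-- The absolute value of a summand of a paraproduct form, with the symbol `b` and the function `φ`
in the two cancellative positions and `ψ` averaged. -/
def formTerm (b φ ψ : (Fin n → ℝ) → ℝ) (ε θ : Fin n → Bool) (Q : Cube n) : ℝ :=
  |haarCoeff b Q ε| * |haarCoeff φ Q θ| * avg (fun x => |ψ x|) Q

lemma formTerm_nonneg (b φ ψ : (Fin n → ℝ) → ℝ) (ε θ : Fin n → Bool) (Q : Cube n) :
    0 ≤ formTerm b φ ψ ε θ Q :=
  mul_nonneg (mul_nonneg (abs_nonneg _) (abs_nonneg _)) (avg_abs_nonneg _ _)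

/-- A superadditive nonnegative set function is superadditive over finite disjoint families. -/
lemma sum_le_of_superadditive {H : Set (Fin n → ℝ) → ℝ} (H0 : ∀ E, 0 ≤ H E)
    (Hadd : ∀ E₁ E₂, MeasurableSet E₁ → MeasurableSet E₂ → Disjoint E₁ E₂ →
      H E₁ + H E₂ ≤ H (E₁ ∪ E₂))
    {ι : Type*} (s : Finset ι) {Ω : ι → Set (Fin n → ℝ)} (hΩ : ∀ i, MeasurableSet (Ω i))
    (hd : Pairwise (Function.onFun Disjoint Ω)) : ∑ i ∈ s, H (Ω i) ≤ H (⋃ i ∈ s, Ω i) := by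
  classical
  induction s using Finset.induction_on with
  | empty => simpa using H0 _
  | insert i s hi ih =>
    rw [Finset.sum_insert hi, Finset.set_biUnion_insert]
    refine (add_le_add_right ih _).trans (Hadd _ _ (hΩ i)
      (Finset.measurableSet_biUnion _ fun j _ => hΩ j) ?_)
    refine Set.disjoint_iUnion₂_right.2 fun j hj => hd ?_
    rintro rfl; exact hi hj

section Stopping

variable (hn : 0 < n) {D : DyadicGrid n} {F : Finset (Cube n)} (hF : ∀ R ∈ F, R ∈ D.cubes)
  {s : ℤ} (hs : ∀ R ∈ F, s ≤ R.scale) {b φ ψ : (Fin n → ℝ) → ℝ} (hb : LocallyIntegrable b)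
  (hφ : LocallyIntegrable φ) (hψ : LocallyIntegrable ψ) {ε θ : Fin n → Bool}
  (hε : ε ∈ cancellative n) (hθ : θ ∈ cancellative n)
  {H : Set (Fin n → ℝ) → ℝ} (H0 : ∀ E, 0 ≤ H E)
  (Hadd : ∀ E₁ E₂, MeasurableSet E₁ → MeasurableSet E₂ → Disjoint E₁ E₂ →
      H E₁ + H E₂ ≤ H (E₁ ∪ E₂))

include hn hF hs hb hφ hψ hε hθ H0 Hadd

/-- The stopping construction below a fixed cube `Q₀`. The functions `b - c`, `φ`, `ψ` are
normalized by `B`, `Φ`, `Ψ`, and the recursion over the cubes `Q ⊆ Q₀` stops at the cubes on which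
the average of the sum `w` of the normalized functions exceeds `6`; `Ω` is the union of the stopping
cubes below `Q`. Above them the sum of the form is controlled by the energies of `b - c` and `φ`,
which by the local Bessel inequality telescope and so never exceed the final value
`2 (6 · 2 ^ n) ^ 2 |Q|`. -/
lemma exists_stopping_set {Q₀ : Cube n} {C B Φ Ψ c : ℝ} (hC : 0 ≤ C) (hB : 0 < B) (hΦ : 0 < Φ)
    (hΨ : 0 < Ψ)
    (hrec : ∀ S ∈ D.cubes, S.toSet ⊆ Q₀.toSet → S.scale < Q₀.scale →
      sumBelow F (formTerm b φ ψ ε θ) S ≤ C * H S.toSet)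
    {w : (Fin n → ℝ) → ℝ} (hw : w = fun x => |b x - c| / B + |φ x| / Φ + |ψ x| / Ψ) (M : ℕ) :
    ∀ Q ∈ D.cubes, Q.toSet ⊆ Q₀.toSet → Q.scale < s + M → ∫ x in Q.toSet, w x ≤ 6 * Q.vol →
      ∃ Ω, MeasurableSet Ω ∧ Ω ⊆ Q.toSet ∧
        sumBelow F (formTerm b φ ψ ε θ) Q ≤ 3 * (B * Φ * Ψ) * (Q.vol *
          (2 * (6 * 2 ^ n) ^ 2 - ((avg b Q - c) / B) ^ 2 - (avg φ Q / Φ) ^ 2)) + C * H Ω ∧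
        6 * volume.real Ω ≤ ∫ x in Ω, w x := by
  have hbc : LocallyIntegrable fun x => b x - c := hb.sub (locallyIntegrable_const c)
  have hwl : LocallyIntegrable w := by
    rw [hw]
    simp only [div_eq_inv_mul]
    exact (((locallyIntegrable_abs hbc).smul B⁻¹).add ((locallyIntegrable_abs hφ).smul Φ⁻¹)).add
      ((locallyIntegrable_abs hψ).smul Ψ⁻¹)
  have hterms : ∀ x, 0 ≤ |b x - c| / B ∧ 0 ≤ |φ x| / Φ ∧ 0 ≤ |ψ x| / Ψ := fun x =>
    ⟨by positivity, by positivity, by positivity⟩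
  have hwb : ∀ x, |b x - c| ≤ B * w x := fun x => by
    rw [← div_le_iff₀' hB, hw]; linarith [hterms x]
  have hwφ : ∀ x, |φ x| ≤ Φ * w x := fun x => by
    rw [← div_le_iff₀' hΦ, hw]; linarith [hterms x]
  have hwψ : ∀ x, |ψ x| ≤ Ψ * w x := fun x => by
    rw [← div_le_iff₀' hΨ, hw]; linarith [hterms x]
  have hpow : (1 : ℝ) ≤ 2 ^ n := one_le_pow₀ (by norm_num)
  have hBΦΨ : 0 < B * Φ * Ψ := by positivity
  -- the energies on `R ⊆ Q` are bounded if `Q` lies above the stopping cubes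
  have henergy : ∀ Q R : Cube n, R.toSet ⊆ Q.toSet → Q.vol ≤ 2 ^ n * R.vol →
      ∫ x in Q.toSet, w x ≤ 6 * Q.vol →
      0 ≤ 2 * (6 * 2 ^ n) ^ 2 - ((avg b R - c) / B) ^ 2 - (avg φ R / Φ) ^ 2 := by
    intro Q R hRQ hvol hQ
    have key : ∀ {f : (Fin n → ℝ) → ℝ} {A : ℝ}, LocallyIntegrable f → 0 < A →
        (∀ x, |f x| ≤ A * w x) → (avg f R / A) ^ 2 ≤ (6 * 2 ^ n) ^ 2 := by
      intro f A hf hA hfw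
      rw [sq_le_sq, abs_div, abs_of_pos hA, div_le_iff₀ hA,
        abs_of_nonneg (a := (6 : ℝ) * 2 ^ n) (by positivity)]
      refine (abs_avg_le f R).trans ((avg_abs_le_of_le_mul hf hwl hA hfw hRQ hQ).trans ?_)
      have : Q.vol / R.vol ≤ 2 ^ n := (div_le_iff₀ R.vol_pos).2 hvol
      nlinarith
    have h1 := key hbc hB hwb
    rw [avg_sub_const hb] at h1
    linarith [key hφ hΦ hwφ]
  induction M with
  | zero =>
    intro Q _ _ hQs hQ
    refine ⟨∅, MeasurableSet.empty, Set.empty_subset _, ?_, by simp⟩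
    rw [sumBelow_eq_zero]
    · have := henergy Q Q subset_rfl (by nlinarith [Q.vol_pos]) hQ
      have := Q.vol_pos
      have := H0 ∅
      positivity
    · intro R hR hRQ
      have h1 := Cube.scale_le_of_subset hn hRQ
      have h2 := hs R hR
      simp only [Nat.cast_zero] at hQs
      omega
  | succ M ih =>
    intro Q hQD hQQ₀ hQs hQ
    have hV := Q.vol_pos
    have hchild : ∀ ω, ∃ Ω, MeasurableSet Ω ∧ Ω ⊆ (Q.child ω).toSet ∧
        sumBelow F (formTerm b φ ψ ε θ) (Q.child ω) ≤ 3 * (B * Φ * Ψ) * ((Q.child ω).vol *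
          (2 * (6 * 2 ^ n) ^ 2 - ((avg b (Q.child ω) - c) / B) ^ 2
            - (avg φ (Q.child ω) / Φ) ^ 2)) + C * H Ω ∧
        6 * volume.real Ω ≤ ∫ x in Ω, w x := by
      intro ω
      have hDω := D.child_mem hn hQD ω
      have hsub := (Q.child_subset ω).trans hQQ₀
      have hscale : (Q.child ω).scale = Q.scale - 1 := rfl
      by_cases hgood : ∫ x in (Q.child ω).toSet, w x ≤ 6 * (Q.child ω).vol
      · exact ih _ hDω hsub (by rw [hscale]; push_cast at hQs; omega) hgood
      · refine ⟨_, (Q.child ω).measurableSet, subset_rfl, ?_, (not_le.1 hgood).le⟩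
        have h1 := hrec _ hDω hsub (by
          have := Cube.scale_le_of_subset hn hQQ₀; rw [hscale]; omega)
        have h2 := henergy Q (Q.child ω) (Q.child_subset ω)
          (by rw [Q.vol_child]; field_simp; exact le_rfl) hQ
        have := (Q.child ω).vol_pos
        have h3 : 0 ≤ 3 * (B * Φ * Ψ) * ((Q.child ω).vol *
          (2 * (6 * 2 ^ n) ^ 2 - ((avg b (Q.child ω) - c) / B) ^ 2
            - (avg φ (Q.child ω) / Φ) ^ 2)) := by positivity
        linarith
    choose Ω hΩm hΩs hΩsum hΩw using hchild
    have hΩd : Pairwise (Function.onFun Disjoint Ω) := fun ω ω' h =>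
      (Q.disjoint_child h).mono (hΩs ω) (hΩs ω')
    refine ⟨⋃ ω, Ω ω, MeasurableSet.iUnion hΩm,
      Set.iUnion_subset fun ω => (hΩs ω).trans (Q.child_subset ω), ?_, ?_⟩
    · have hH : ∑ ω, H (Ω ω) ≤ H (⋃ ω, Ω ω) := by
        simpa using sum_le_of_superadditive H0 Hadd Finset.univ hΩm hΩd
      have hψQ : avg (fun x => |ψ x|) Q ≤ 6 * Ψ := by
        have := avg_abs_le_of_le_mul hψ hwl hΨ hwψ subset_rfl hQ
        rwa [div_self hV.ne', mul_one] at this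
      have hbQ := sq_haarCoeff_le hb Q hε c
      have hφQ := sq_haarCoeff_le hφ Q hθ 0
      simp only [sub_zero] at hφQ
      have hterm : formTerm b φ ψ ε θ Q ≤ 3 * (B * Φ * Ψ) *
          (haarCoeff b Q ε ^ 2 / B ^ 2 + haarCoeff φ Q θ ^ 2 / Φ ^ 2) := by
        have hamgm : |haarCoeff b Q ε| * |haarCoeff φ Q θ| ≤
            B * Φ / 2 * (haarCoeff b Q ε ^ 2 / B ^ 2 + haarCoeff φ Q θ ^ 2 / Φ ^ 2) := by
          have := two_mul_le_add_sq (|haarCoeff b Q ε| / B) (|haarCoeff φ Q θ| / Φ)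
          rw [div_pow, div_pow, sq_abs, sq_abs] at this
          calc _ = B * Φ / 2 * (2 * (|haarCoeff b Q ε| / B) * (|haarCoeff φ Q θ| / Φ)) := by
                field_simp
            _ ≤ _ := mul_le_mul_of_nonneg_left this (by positivity)
        calc formTerm b φ ψ ε θ Q ≤ (B * Φ / 2 * (haarCoeff b Q ε ^ 2 / B ^ 2 +
              haarCoeff φ Q θ ^ 2 / Φ ^ 2)) * (6 * Ψ) :=
              mul_le_mul hamgm hψQ (avg_abs_nonneg _ _) (by positivity)
          _ = _ := by ring
      have hb' : haarCoeff b Q ε ^ 2 / B ^ 2 ≤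
          ∑ ω, (Q.child ω).vol * ((avg b (Q.child ω) - c) / B) ^ 2
            - Q.vol * ((avg b Q - c) / B) ^ 2 := by
        refine (div_le_div_of_nonneg_right hbQ (by positivity)).trans_eq ?_
        simp only [sub_div (Finset.sum _ _), Finset.sum_div, div_pow, mul_div_assoc]
      have hφ' : haarCoeff φ Q θ ^ 2 / Φ ^ 2 ≤
          ∑ ω, (Q.child ω).vol * (avg φ (Q.child ω) / Φ) ^ 2 - Q.vol * (avg φ Q / Φ) ^ 2 := by
        refine (div_le_div_of_nonneg_right hφQ (by positivity)).trans_eq ?_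
        simp only [sub_div, Finset.sum_div, div_pow, mul_div_assoc]
      have hvol : ∑ ω : Fin n → Bool, (Q.child ω).vol = Q.vol := by
        simp only [Q.vol_child, Finset.sum_const, nsmul_eq_mul]
        simp; field_simp
      have hsum : ∑ ω, sumBelow F (formTerm b φ ψ ε θ) (Q.child ω) ≤
          3 * (B * Φ * Ψ) * (2 * (6 * 2 ^ n) ^ 2 * Q.vol
            - ∑ ω, (Q.child ω).vol * ((avg b (Q.child ω) - c) / B) ^ 2
            - ∑ ω, (Q.child ω).vol * (avg φ (Q.child ω) / Φ) ^ 2) + C * ∑ ω, H (Ω ω) := by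
        refine (Finset.sum_le_sum fun ω _ => hΩsum ω).trans_eq ?_
        rw [Finset.sum_add_distrib, ← Finset.mul_sum, ← Finset.mul_sum, ← hvol,
          Finset.mul_sum (a := 2 * (6 * 2 ^ n) ^ 2), ← Finset.sum_sub_distrib,
          ← Finset.sum_sub_distrib]
        congr 2
        exact Finset.sum_congr rfl fun ω _ => by ring
      have h1 := sumBelow_le hn D hF (formTerm_nonneg b φ ψ ε θ) hQD
      have h2 := mul_le_mul_of_nonneg_left (add_le_add hb' hφ') (by positivity : 0 ≤ 3 * (B * Φ * Ψ))
      have h3 := mul_le_mul_of_nonneg_left hH hC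
      linarith
    · rw [measureReal_def, measure_iUnion hΩd hΩm, tsum_fintype, ENNReal.toReal_sum,
        integral_iUnion_fintype hΩm hΩd fun ω =>
          ((Q.child ω).integrableOn hwl).mono_set (hΩs ω), Finset.mul_sum]
      · exact Finset.sum_le_sum fun ω _ => hΩw ω
      · exact fun ω _ => measure_ne_top_of_subset (hΩs ω) (Q.child ω).volume_ne_top

/-- Sparse domination below a cube. The set function `H` plays the role of the sparse sum: each
stopping cube `S` is charged to the part `E` of `S` outside the next generation of stopping cubes,
which has at least half of the measure, and superadditivity collects the charges. -/
lemma sumBelow_formTerm_le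
    (hclosed : ∀ Q ∈ F, ∀ S ∈ D.cubes, S.toSet ⊆ Q.toSet → s ≤ S.scale → S ∈ F)
    (hH : ∀ S ∈ F, ∀ E ⊆ S.toSet, MeasurableSet E → S.vol ≤ 2 * volume.real E →
      avg (fun x => |φ x|) S * avg (fun x => |ψ x|) S * ∫ x in S.toSet, |b x - avg b S| ≤ H E)
    (N : ℕ) : ∀ Q ∈ D.cubes, Q.scale < s + N → (s ≤ Q.scale → Q ∈ F) →
      sumBelow F (formTerm b φ ψ ε θ) Q ≤ 216 * 4 ^ n * H Q.toSet := by
  induction N with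
  | zero =>
    intro Q _ hQs _
    rw [sumBelow_eq_zero]
    · have := H0 Q.toSet
      positivity
    · intro R hR hRQ
      have h1 := Cube.scale_le_of_subset hn hRQ
      have h2 := hs R hR
      simp only [Nat.cast_zero] at hQs
      omega
  | succ N ih =>
    intro Q hQD hQs hQF
    by_cases hsQ : s ≤ Q.scale
    swap
    · exact ih Q hQD (by omega) hQF
    specialize hQF hsQ
    have hV := Q.vol_pos
    set c := avg b Q with hc
    have hbc : LocallyIntegrable fun x => b x - c := hb.sub (locallyIntegrable_const c)
    set B := avg (fun x => |b x - c|) Q with hBdef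
    set Φ := avg (fun x => |φ x|) Q with hΦdef
    set Ψ := avg (fun x => |ψ x|) Q with hΨdef
    have hzero : ∀ {f : (Fin n → ℝ) → ℝ}, LocallyIntegrable f → avg (fun x => |f x|) Q = 0 →
        ∀ R : Cube n, R.toSet ⊆ Q.toSet → ∫ x in R.toSet, |f x| = 0 := by
      intro f hf h R hR
      refine le_antisymm ?_ (integral_nonneg fun _ => abs_nonneg _)
      rw [avg_eq, div_eq_zero_iff, or_iff_left hV.ne'] at h
      rw [← h]
      exact setIntegral_mono_set (Q.integrableOn (locallyIntegrable_abs hf))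
        (.of_forall fun _ => abs_nonneg _) (LE.le.eventuallyLE hR)
    by_cases hpos : B = 0 ∨ Φ = 0 ∨ Ψ = 0
    · rw [sumBelow_eq_zero]
      · have := H0 Q.toSet
        positivity
      intro R _ hRQ
      rcases hpos with h | h | h
      · have hbR : haarCoeff b R ε ^ 2 ≤ 0 := by
          refine (sq_haarCoeff_le hb R hε c).trans ?_
          rw [Finset.sum_eq_zero, zero_sub, neg_nonpos]
          · have := R.vol_pos
            positivity
          intro ω _
          have h0 := abs_avg_le (fun x => b x - c) (R.child ω)
          rw [avg_eq (fun x => |b x - c|), hzero hbc h _ ((R.child_subset ω).trans hRQ), zero_div,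
            avg_sub_const hb] at h0
          rw [abs_nonpos_iff.1 h0]; ring
        rw [formTerm, pow_eq_zero_iff two_ne_zero |>.1 (le_antisymm hbR (sq_nonneg _))]
        simp
      · have := abs_haarCoeff_le hφ R θ
        rw [hzero hφ h R hRQ, mul_zero, abs_nonpos_iff] at this
        rw [formTerm, this]; simp
      · rw [formTerm, avg_eq, hzero hψ h R hRQ]; simp
    push Not at hpos
    have hB : 0 < B := lt_of_le_of_ne (avg_abs_nonneg _ _) hpos.1.symm
    have hΦ : 0 < Φ := lt_of_le_of_ne (avg_abs_nonneg _ _) hpos.2.1.symm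
    have hΨ : 0 < Ψ := lt_of_le_of_ne (avg_abs_nonneg _ _) hpos.2.2.symm
    set w : (Fin n → ℝ) → ℝ := fun x => |b x - c| / B + |φ x| / Φ + |ψ x| / Ψ with hw
    have i1 := (Q.integrableOn (locallyIntegrable_abs hbc)).div_const B
    have i2 := (Q.integrableOn (locallyIntegrable_abs hφ)).div_const Φ
    have i3 := (Q.integrableOn (locallyIntegrable_abs hψ)).div_const Ψ
    have hwint : IntegrableOn w Q.toSet := (i1.add i2).add i3
    have hwQ : ∫ x in Q.toSet, w x = 3 * Q.vol := by
      have e1 : ∫ x in Q.toSet, |b x - c| = Q.vol * B := (vol_mul_avg _ Q).symm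
      have e2 : ∫ x in Q.toSet, |φ x| = Q.vol * Φ := (vol_mul_avg _ Q).symm
      have e3 : ∫ x in Q.toSet, |ψ x| = Q.vol * Ψ := (vol_mul_avg _ Q).symm
      have e : ∫ x in Q.toSet, w x = _ := integral_add (i1.add i2) i3
      have e' : ∫ x in Q.toSet, ((fun x => |b x - c| / B) + fun x => |φ x| / Φ) x = _ :=
        integral_add i1 i2
      rw [e]
      refine (congrArg (· + ∫ x in Q.toSet, |ψ x| / Ψ) e').trans ?_
      simp only [integral_div]
      rw [e1, e2, e3]
      field_simp
      ring
    obtain ⟨Ω, hΩm, hΩQ, hΩsum, hΩw⟩ := exists_stopping_set hn hF hs hb hφ hψ hε hθ H0 Hadd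
      (C := 216 * 4 ^ n) (by positivity) hB hΦ hΨ
      (fun S hS hSQ hlt => ih S hS (by push_cast at hQs; omega) (hclosed Q hQF S hS hSQ))
      hw (N + 1) Q hQD subset_rfl hQs (by rw [hwQ]; linarith)
    -- the stopping cubes cover at most half of `Q`
    have hΩvol : 2 * volume.real Ω ≤ Q.vol := by
      have : ∫ x in Ω, w x ≤ ∫ x in Q.toSet, w x :=
        setIntegral_mono_set hwint (.of_forall fun x => by simp only [hw, Pi.zero_apply]; positivity)
          (LE.le.eventuallyLE hΩQ)
      linarith
    have hEvol : volume.real (Q.toSet \ Ω) = Q.vol - volume.real Ω :=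
      measureReal_sdiff hΩQ hΩm Q.volume_ne_top
    have hE := hH Q hQF (Q.toSet \ Ω) Set.sdiff_subset (Q.measurableSet.diff hΩm) (by linarith)
    have hHadd := Hadd _ _ (Q.measurableSet.diff hΩm) hΩm Set.disjoint_sdiff_left
    rw [Set.sdiff_union_of_subset hΩQ] at hHadd
    rw [← vol_mul_avg] at hE
    have hdrop : 3 * (B * Φ * Ψ) * (Q.vol * (2 * (6 * 2 ^ n) ^ 2 - ((avg b Q - c) / B) ^ 2
        - (avg φ Q / Φ) ^ 2)) ≤ 216 * 4 ^ n * (Φ * Ψ * (Q.vol * B)) := by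
      have h4 : (4 : ℝ) ^ n = (2 ^ n) ^ 2 := by rw [← pow_mul, mul_comm, pow_mul]; norm_num
      have : 3 * (B * Φ * Ψ) * (Q.vol * (2 * (6 * 2 ^ n) ^ 2 - ((avg b Q - c) / B) ^ 2
        - (avg φ Q / Φ) ^ 2)) ≤ 3 * (B * Φ * Ψ) * (Q.vol * (2 * (6 * 2 ^ n) ^ 2)) := by
        gcongr
        linarith [sq_nonneg ((avg b Q - c) / B), sq_nonneg (avg φ Q / Φ)]
      refine this.trans_eq ?_
      rw [h4]; ring
    calc sumBelow F (formTerm b φ ψ ε θ) Q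
        ≤ 216 * 4 ^ n * H (Q.toSet \ Ω) + 216 * 4 ^ n * H Ω :=
          hΩsum.trans (add_le_add_left (hdrop.trans (mul_le_mul_of_nonneg_left hE (by positivity))) _)
      _ = 216 * 4 ^ n * (H (Q.toSet \ Ω) + H Ω) := by ring
      _ ≤ _ := mul_le_mul_of_nonneg_left hHadd (by positivity)

/-- Sparse domination of the form over a finite family of cubes. -/
lemma sum_formTerm_le
    (hclosed : ∀ Q ∈ F, ∀ S ∈ D.cubes, S.toSet ⊆ Q.toSet → s ≤ S.scale → S ∈ F)
    (hH : ∀ S ∈ F, ∀ E ⊆ S.toSet, MeasurableSet E → S.vol ≤ 2 * volume.real E →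
      avg (fun x => |φ x|) S * avg (fun x => |ψ x|) S * ∫ x in S.toSet, |b x - avg b S| ≤ H E) :
    ∑ Q ∈ F, formTerm b φ ψ ε θ Q ≤ 216 * 4 ^ n * H Set.univ := by
  classical
  suffices h : ∀ G ⊆ F, ∑ Q ∈ G, formTerm b φ ψ ε θ Q ≤ 216 * 4 ^ n * H (⋃ Q ∈ G, Q.toSet) by
    refine (h F subset_rfl).trans (mul_le_mul_of_nonneg_left ?_ (by positivity))
    have hm : MeasurableSet (⋃ Q ∈ F, Q.toSet) :=
      Finset.measurableSet_biUnion _ fun Q _ => Q.measurableSet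
    have := Hadd _ _ hm hm.compl disjoint_compl_right
    rw [Set.union_compl_self] at this
    linarith [H0 (⋃ Q ∈ F, Q.toSet)ᶜ]
  intro G
  induction hk : G.card using Nat.strong_induction_on generalizing G with
  | _ k ih =>
  intro hG
  obtain rfl | hne := G.eq_empty_or_nonempty
  · have := H0 (⋃ Q ∈ (∅ : Finset (Cube n)), Q.toSet)
    simp only [Finset.sum_empty]
    positivity
  obtain ⟨Q, hQG, hmax⟩ := Finset.exists_max_image G Cube.scale hne
  have hQF := hG hQG
  set G' := G.filter fun R => ¬R.toSet ⊆ Q.toSet with hG'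
  have hlt : G'.card < k := by
    rw [← hk]
    exact Finset.card_lt_card (Finset.filter_ssubset.2 ⟨Q, hQG, by simp⟩)
  have h1 := ih _ hlt G' rfl ((Finset.filter_subset _ _).trans hG)
  have h2 : ∑ R ∈ G.filter fun R => R.toSet ⊆ Q.toSet, formTerm b φ ψ ε θ R ≤
      216 * 4 ^ n * H Q.toSet := by
    refine le_trans ?_ (sumBelow_formTerm_le hn hF hs hb hφ hψ hε hθ H0 Hadd hclosed hH
      (Q.scale - s + 1).toNat Q (hF Q hQF) (by omega) fun _ => hQF)
    exact Finset.sum_le_sum_of_subset_of_nonneg (Finset.filter_subset_filter _ hG)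
      fun R _ _ => formTerm_nonneg _ _ _ _ _ R
  have hd : Disjoint Q.toSet (⋃ R ∈ G', R.toSet) := by
    refine Set.disjoint_iUnion₂_right.2 fun R hR => ?_
    obtain ⟨hRG, hRQ⟩ := Finset.mem_filter.1 hR
    exact ((D.subset_or_disjoint hn (hF R (hG hRG)) (hF Q hQF) (hmax R hRG)).resolve_left
      hRQ).symm
  have hU : Q.toSet ∪ ⋃ R ∈ G', R.toSet = ⋃ R ∈ G, R.toSet := by
    refine Set.Subset.antisymm (Set.union_subset (Set.subset_biUnion_of_mem (u := Cube.toSet) hQG)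
      (Set.biUnion_subset_biUnion_left (Finset.filter_subset _ _))) ?_
    refine Set.iUnion₂_subset fun R hR => ?_
    by_cases h : R.toSet ⊆ Q.toSet
    · exact h.trans Set.subset_union_left
    · exact Set.subset_union_of_subset_right (Set.subset_biUnion_of_mem (u := Cube.toSet)
        (s := (G' : Set (Cube n))) (Finset.mem_coe.2 (Finset.mem_filter.2 ⟨hR, h⟩))) _
  have h3 := Hadd _ _ Q.measurableSet (Finset.measurableSet_biUnion G' fun R _ => R.measurableSet) hd
  rw [hU] at h3
  rw [← Finset.sum_filter_add_sum_filter_not G fun R => R.toSet ⊆ Q.toSet]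
  calc _ ≤ 216 * 4 ^ n * H Q.toSet + 216 * 4 ^ n * H (⋃ R ∈ G', R.toSet) := add_le_add h2 h1
    _ = 216 * 4 ^ n * (H Q.toSet + H (⋃ R ∈ G', R.toSet)) := by ring
    _ ≤ _ := mul_le_mul_of_nonneg_left h3 (by positivity)

end Stopping

end SparseDomination

/-! ### The dyadic maximal function of a measure -/

section MaximalFunction

variable {n : ℕ}

/-- The dyadic maximal function of `h` with respect to the measure `ρ`, over a finite family `F` of
cubes. -/
def maxFun (ρ : Measure (Fin n → ℝ)) (h : (Fin n → ℝ) → ℝ≥0∞) (F : Finset (Cube n))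
    (x : Fin n → ℝ) : ℝ≥0∞ :=
  F.sup fun Q => Q.toSet.indicator (fun _ => (∫⁻ y in Q.toSet, h y ∂ρ) / ρ Q.toSet) x

variable {ρ : Measure (Fin n → ℝ)} {h : (Fin n → ℝ) → ℝ≥0∞}

lemma measurable_maxFun (F : Finset (Cube n)) : Measurable (maxFun ρ h F) := by
  classical
  unfold maxFun
  induction F using Finset.induction_on with
  | empty => simp
  | insert Q F _ ih =>
    simp only [Finset.sup_insert]
    exact (measurable_const.indicator Q.measurableSet).sup ih

lemma le_maxFun {F : Finset (Cube n)} {Q : Cube n} (hQ : Q ∈ F) {x : Fin n → ℝ}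
    (hx : x ∈ Q.toSet) : (∫⁻ y in Q.toSet, h y ∂ρ) / ρ Q.toSet ≤ maxFun ρ h F x := by
  have := Finset.le_sup (f := fun Q : Cube n =>
    Q.toSet.indicator (fun _ => (∫⁻ y in Q.toSet, h y ∂ρ) / ρ Q.toSet) x) hQ
  rwa [Set.indicator_of_mem hx] at this

/-- Young's inequality, as the concavity inequality that is used when the maximal function jumps
from the value `m` to the value `x`. -/
lemma young_jump {p q : ℝ} (hpq : p.HolderConjugate q) {m x : ℝ≥0∞} (hm : m ≠ ∞) (hx : x ≠ ∞) :
    x ^ p + ENNReal.ofReal q * (m ^ (p - 1) * x) ≤ m ^ p + ENNReal.ofReal q * x ^ p := by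
  lift m to ℝ≥0 using hm
  lift x to ℝ≥0 using hx
  have hp1 : 0 < p - 1 := sub_pos.2 hpq.lt
  rw [ENNReal.ofReal, ← ENNReal.coe_rpow_of_nonneg _ hpq.nonneg,
    ← ENNReal.coe_rpow_of_nonneg _ hpq.nonneg, ← ENNReal.coe_rpow_of_nonneg _ hp1.le]
  norm_cast
  rw [← NNReal.coe_le_coe]
  push_cast
  rw [Real.coe_toNNReal _ hpq.symm.nonneg]
  have hy := Real.young_inequality_of_nonneg x.coe_nonneg
    (Real.rpow_nonneg m.coe_nonneg (p - 1)) hpq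
  rw [← Real.rpow_mul m.coe_nonneg, hpq.sub_one_mul_conj] at hy
  have hy' := mul_le_mul_of_nonneg_left hy hpq.symm.nonneg
  have hqp : q / p = q - 1 := hpq.symm.div_conj_eq_sub_one
  have hq0 := hpq.symm.pos
  have : q * ((x : ℝ) ^ p / p + (m : ℝ) ^ p / q) = (q - 1) * (x : ℝ) ^ p + (m : ℝ) ^ p := by
    rw [← hqp]; field_simp
  rw [this] at hy'
  linarith

lemma maxFun_eq_of_mem {F : Finset (Cube n)} {Q : Cube n}
    (hQ : ∀ R ∈ F, Q.toSet ⊆ R.toSet ∨ Disjoint Q.toSet R.toSet) {x y : Fin n → ℝ}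
    (hx : x ∈ Q.toSet) (hy : y ∈ Q.toSet) : maxFun ρ h F x = maxFun ρ h F y := by
  refine Finset.sup_congr rfl fun R hR => ?_
  rcases hQ R hR with hs | hd
  · rw [Set.indicator_of_mem (hs hx), Set.indicator_of_mem (hs hy)]
  · rw [Set.indicator_of_notMem (Set.disjoint_left.1 hd hx),
      Set.indicator_of_notMem (Set.disjoint_left.1 hd hy)]

/-- Doob's inequality before Hölder's inequality is applied. The cubes are added to the family in
the order of decreasing size, so that the maximal function is constant on each added cube. -/
lemma lintegral_maxFun_rpow_le (hn : 0 < n) {D : DyadicGrid n} {p q : ℝ}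
    (hpq : p.HolderConjugate q) (F : Finset (Cube n)) (hF : ∀ Q ∈ F, Q ∈ D.cubes)
    (hρ : ∀ Q ∈ F, ρ Q.toSet ≠ ∞) (hh : ∀ Q ∈ F, ∫⁻ y in Q.toSet, h y ∂ρ ≠ ∞) :
    ∫⁻ x, maxFun ρ h F x ^ p ∂ρ ≠ ∞ ∧ ∫⁻ x, maxFun ρ h F x ^ p ∂ρ ≤
      ENNReal.ofReal q * ∫⁻ x, maxFun ρ h F x ^ (p - 1) * h x ∂ρ := by
  classical
  have hp1 : 0 < p - 1 := sub_pos.2 hpq.lt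
  induction F using Finset.induction_on_max_value (fun Q : Cube n => -Q.scale) with
  | empty => simp [maxFun, ENNReal.zero_rpow_of_pos hpq.pos]
  | insert Q F hQF hmin ih =>
    obtain ⟨ihfin, ih⟩ := ih (fun R hR => hF R (Finset.mem_insert_of_mem hR))
      (fun R hR => hρ R (Finset.mem_insert_of_mem hR))
      (fun R hR => hh R (Finset.mem_insert_of_mem hR))
    have hQD := hF Q (Finset.mem_insert_self _ _)
    have hlam : ∀ R ∈ F, Q.toSet ⊆ R.toSet ∨ Disjoint Q.toSet R.toSet := fun R hR =>
      D.subset_or_disjoint hn hQD (hF R (Finset.mem_insert_of_mem hR))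
        (by have := hmin R hR; omega)
    set A := ∫⁻ y in Q.toSet, h y ∂ρ with hA
    set r := ρ Q.toSet with hr
    have hr_top : r ≠ ∞ := hρ Q (Finset.mem_insert_self _ _)
    have hA_top : A ≠ ∞ := hh Q (Finset.mem_insert_self _ _)
    set u := maxFun ρ h F with hu
    set m := u Q.corner with hm
    have hum : ∀ x ∈ Q.toSet, u x = m := fun x hx => maxFun_eq_of_mem hlam hx Q.corner_mem
    have hins : ∀ x, maxFun ρ h (insert Q F) x = max (Q.toSet.indicator (fun _ => A / r) x) (u x) :=
      fun x => Finset.sup_insert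
    by_cases hle : A / r ≤ m
    · have : maxFun ρ h (insert Q F) = u := by
        funext x
        rw [hins, max_eq_right]
        by_cases hx : x ∈ Q.toSet
        · rwa [Set.indicator_of_mem hx, hum x hx]
        · simp [hx]
      rw [this]; exact ⟨ihfin, ih⟩
    rw [not_le] at hle
    have hr0 : r ≠ 0 := by
      intro h0
      have : A = 0 := setLIntegral_measure_zero _ _ h0
      simp [this] at hle
    have hon : ∀ x ∈ Q.toSet, maxFun ρ h (insert Q F) x = A / r := fun x hx => by
      rw [hins, Set.indicator_of_mem hx, hum x hx, max_eq_left hle.le]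
    have hoff : ∀ x ∈ Q.toSetᶜ, maxFun ρ h (insert Q F) x = u x := fun x hx => by
      rw [hins, Set.indicator_of_notMem hx]; simp
    have hx_top : A / r ≠ ∞ := (ENNReal.div_lt_top hA_top hr0).ne
    have hm_top : m ≠ ∞ := (hle.trans_le le_top).ne
    have hAr : A / r * r = A := ENNReal.div_mul_cancel hr0 hr_top
    have split : ∀ g : (Fin n → ℝ) → ℝ≥0∞, ∫⁻ x, g x ∂ρ =
        ∫⁻ x in Q.toSetᶜ, g x ∂ρ + ∫⁻ x in Q.toSet, g x ∂ρ := fun g => by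
      rw [add_comm, lintegral_add_compl _ Q.measurableSet]
    have hmeas := Q.measurableSet
    -- the integrals for the new and the old maximal function
    have e1 : ∫⁻ x, maxFun ρ h (insert Q F) x ^ p ∂ρ =
        ∫⁻ x in Q.toSetᶜ, u x ^ p ∂ρ + (A / r) ^ p * r := by
      rw [split, setLIntegral_congr_fun hmeas.compl fun x hx => by rw [hoff x hx],
        setLIntegral_congr_fun hmeas (g := fun _ => (A / r) ^ p) fun x hx => by rw [hon x hx],
        setLIntegral_const]
    have e2 : ∫⁻ x, u x ^ p ∂ρ = ∫⁻ x in Q.toSetᶜ, u x ^ p ∂ρ + m ^ p * r := by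
      rw [split, setLIntegral_congr_fun hmeas (g := fun _ => m ^ p) fun x hx => by rw [hum x hx],
        setLIntegral_const]
    have e3 : ∫⁻ x, maxFun ρ h (insert Q F) x ^ (p - 1) * h x ∂ρ =
        ∫⁻ x in Q.toSetᶜ, u x ^ (p - 1) * h x ∂ρ + (A / r) ^ p * r := by
      rw [split, setLIntegral_congr_fun hmeas.compl fun x hx => by rw [hoff x hx],
        setLIntegral_congr_fun hmeas (g := fun x => (A / r) ^ (p - 1) * h x)
          fun x hx => by rw [hon x hx],
        lintegral_const_mul' _ _ (ENNReal.rpow_ne_top_of_nonneg hp1.le hx_top), ← hA]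
      congr 1
      nth_rw 2 [← hAr]
      rw [← mul_assoc]
      congr 1
      nth_rw 2 [← ENNReal.rpow_one (A / r)]
      rw [← ENNReal.rpow_add_of_nonneg _ _ hp1.le zero_le_one, sub_add_cancel]
    have e4 : ∫⁻ x, u x ^ (p - 1) * h x ∂ρ =
        ∫⁻ x in Q.toSetᶜ, u x ^ (p - 1) * h x ∂ρ + m ^ (p - 1) * (A / r) * r := by
      rw [split, setLIntegral_congr_fun hmeas (g := fun x => m ^ (p - 1) * h x)
          fun x hx => by rw [hum x hx],
        lintegral_const_mul' _ _ (ENNReal.rpow_ne_top_of_nonneg hp1.le hm_top), ← hA, mul_assoc,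
        hAr]
    constructor
    · rw [e1]
      refine ENNReal.add_ne_top.2 ⟨ne_top_of_le_ne_top ihfin (setLIntegral_le_lintegral _ _), ?_⟩
      exact ENNReal.mul_ne_top (ENNReal.rpow_ne_top_of_nonneg hpq.nonneg hx_top) hr_top
    rw [e1, e3]
    rw [e2, e4] at ih
    set a := ∫⁻ x in Q.toSetᶜ, u x ^ p ∂ρ
    set b := ∫⁻ x in Q.toSetᶜ, u x ^ (p - 1) * h x ∂ρ
    have hy := mul_le_mul_left (young_jump hpq hm_top hx_top) r
    have hfin : ENNReal.ofReal q * (m ^ (p - 1) * (A / r) * r) ≠ ∞ :=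
      ENNReal.mul_ne_top ENNReal.ofReal_ne_top (ENNReal.mul_ne_top (ENNReal.mul_ne_top
        (ENNReal.rpow_ne_top_of_nonneg hp1.le hm_top) hx_top) hr_top)
    refine (ENNReal.add_le_add_iff_right hfin).1 ?_
    calc a + (A / r) ^ p * r + ENNReal.ofReal q * (m ^ (p - 1) * (A / r) * r)
        = a + ((A / r) ^ p + ENNReal.ofReal q * (m ^ (p - 1) * (A / r))) * r := by ring
      _ ≤ a + (m ^ p + ENNReal.ofReal q * (A / r) ^ p) * r := by gcongr
      _ = (a + m ^ p * r) + ENNReal.ofReal q * ((A / r) ^ p * r) := by ring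
      _ ≤ ENNReal.ofReal q * (b + m ^ (p - 1) * (A / r) * r)
          + ENNReal.ofReal q * ((A / r) ^ p * r) := by gcongr
      _ = _ := by ring

/-- The dyadic maximal function of a measure `ρ` is bounded on `L^p(ρ)`, with a constant that does
not depend on `ρ`. -/
theorem lintegral_maxFun_rpow_le_lintegral_rpow (hn : 0 < n) {D : DyadicGrid n} {p q : ℝ}
    (hpq : p.HolderConjugate q) (F : Finset (Cube n)) (hF : ∀ Q ∈ F, Q ∈ D.cubes)
    (hρ : ∀ Q ∈ F, ρ Q.toSet ≠ ∞) (hh : ∀ Q ∈ F, ∫⁻ y in Q.toSet, h y ∂ρ ≠ ∞)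
    (hm : AEMeasurable h ρ) :
    (∫⁻ x, maxFun ρ h F x ^ p ∂ρ) ^ (1 / p) ≤
      ENNReal.ofReal q * (∫⁻ x, h x ^ p ∂ρ) ^ (1 / p) := by
  obtain ⟨hfin, hle⟩ := lintegral_maxFun_rpow_le hn hpq F hF hρ hh
  set I := ∫⁻ x, maxFun ρ h F x ^ p ∂ρ with hI
  have hp1 : 0 < p - 1 := sub_pos.2 hpq.lt
  have hHol := ENNReal.lintegral_mul_le_Lp_mul_Lq ρ hpq.symm
    (((measurable_maxFun (ρ := ρ) (h := h) F).pow_const (p - 1)).aemeasurable (μ := ρ)) hm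
  simp only [Pi.mul_apply, ← ENNReal.rpow_mul, hpq.sub_one_mul_conj, ← hI] at hHol
  by_cases h0 : I = 0
  · rw [h0, ENNReal.zero_rpow_of_pos (by have := hpq.pos; positivity)]; exact zero_le
  have hsum : 1 / p + 1 / q = 1 := by simpa [one_div] using hpq.inv_add_inv_eq_one
  have hsplit : I = I ^ (1 / q) * I ^ (1 / p) := by
    rw [← ENNReal.rpow_add _ _ h0 hfin, add_comm, hsum, ENNReal.rpow_one]
  have hq0 : I ^ (1 / q) ≠ 0 := by
    simp [ENNReal.rpow_eq_zero_iff, h0, hfin]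
  have hqt : I ^ (1 / q) ≠ ∞ :=
    ENNReal.rpow_ne_top_of_nonneg (by have := hpq.symm.pos; positivity) hfin
  refine (ENNReal.mul_le_mul_iff_right hq0 hqt).1 ?_
  rw [← hsplit]
  calc I ≤ _ := hle
    _ ≤ _ := mul_le_mul_right hHol _
    _ = _ := by ring

end MaximalFunction

/-! ### Weights -/

section Weights

variable {n : ℕ}

lemma weightMeasure_apply (w : (Fin n → ℝ) → ℝ) (E : Set (Fin n → ℝ)) :
    weightMeasure w E = ∫⁻ x in E, ENNReal.ofReal (w x) :=
  withDensity_apply' _ _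

lemma IsWeight.aemeasurable {w : (Fin n → ℝ) → ℝ} (hw : IsWeight w) : AEMeasurable w :=
  hw.1.aestronglyMeasurable.aemeasurable

lemma aemeasurable_conjWeight {w : (Fin n → ℝ) → ℝ} (hw : IsWeight w) (p : ℝ) :
    AEMeasurable (conjWeight p w) :=
  hw.aemeasurable.pow_const _

lemma ae_conjWeight_pos {w : (Fin n → ℝ) → ℝ} (hw : IsWeight w) (p : ℝ) :
    ∀ᵐ x, 0 < conjWeight p w x := by
  filter_upwards [hw.2] with x hx using Real.rpow_pos_of_pos hx _

lemma weightMeasure_ne_top {w : (Fin n → ℝ) → ℝ} (hw : IsWeight w) (Q : Cube n) :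
    weightMeasure w Q.toSet ≠ ∞ := by
  rw [weightMeasure_apply]
  exact (Q.integrableOn hw.1).lintegral_lt_top.ne

lemma weightMeasure_ne_zero {w : (Fin n → ℝ) → ℝ} (hm : AEMeasurable w) (hw : ∀ᵐ x, 0 < w x)
    (Q : Cube n) : weightMeasure w Q.toSet ≠ 0 := by
  rw [weightMeasure_apply]
  intro h
  rw [lintegral_eq_zero_iff' hm.restrict.ennreal_ofReal] at h
  have hfalse : ∀ᵐ _ ∂volume.restrict Q.toSet, False := by
    filter_upwards [h, ae_restrict_of_ae hw] with x h1 h2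
    exact (ENNReal.ofReal_pos.2 h2).ne' h1
  rw [ae_iff] at hfalse
  simp only [not_false_eq_true, Set.ofPred_true, Measure.restrict_apply_univ] at hfalse
  rw [← Q.ofReal_vol] at hfalse
  exact (ENNReal.ofReal_pos.2 Q.vol_pos).ne' hfalse

/-- Hölder's inequality for two weights. -/
lemma setLIntegral_rpow_mul_rpow_le {p q : ℝ} (hpq : p.HolderConjugate q)
    {u v : (Fin n → ℝ) → ℝ} (hu : AEMeasurable u) (hv : AEMeasurable v)
    (hu0 : ∀ᵐ x, 0 < u x) (hv0 : ∀ᵐ x, 0 < v x) (E : Set (Fin n → ℝ)) :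
    ∫⁻ x in E, ENNReal.ofReal (u x ^ (1 / p) * v x ^ (1 / q)) ≤
      weightMeasure u E ^ (1 / p) * weightMeasure v E ^ (1 / q) := by
  have hp := hpq.pos
  have hq := hpq.symm.pos
  have hH := ENNReal.lintegral_mul_le_Lp_mul_Lq (volume.restrict E) hpq
    (hu.restrict (s := E) |>.ennreal_ofReal.pow_const (1 / p))
    (hv.restrict (s := E) |>.ennreal_ofReal.pow_const (1 / q))
  simp only [Pi.mul_apply, ← ENNReal.rpow_mul, one_div_mul_cancel hp.ne',
    one_div_mul_cancel hq.ne', ENNReal.rpow_one] at hH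
  rw [weightMeasure_apply, weightMeasure_apply]
  refine le_trans (lintegral_mono_ae ?_) hH
  filter_upwards [ae_restrict_of_ae hu0, ae_restrict_of_ae hv0] with x hx hy
  rw [ENNReal.ofReal_mul (by positivity), ENNReal.ofReal_rpow_of_pos hx,
    ENNReal.ofReal_rpow_of_pos hy]

section Ap

variable {D : DyadicGrid n} {p : ℝ} (hp : 1 < p) {w : (Fin n → ℝ) → ℝ}

lemma conjWeight_rpow {x : Fin n → ℝ} (hp : 1 < p) (hx : 0 < w x) :
    conjWeight p w x ^ (1 / p.conjExponent) = w x ^ (-(1 / p)) := by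
  have hpq := Real.HolderConjugate.conjExponent hp
  have hq := hpq.symm.pos
  have : (1 - p.conjExponent) * (1 / p.conjExponent) = -(1 / p) := by
    have := hpq.inv_add_inv_eq_one
    field_simp at this ⊢
    linarith
  rw [conjWeight, ← Real.rpow_mul hx.le, this]

lemma le_apChar {Q : Cube n} (hQ : Q ∈ D.cubes) :
    weightMeasure w Q.toSet / volume Q.toSet *
      (weightMeasure (conjWeight p w) Q.toSet / volume Q.toSet) ^ (p - 1) ≤ apChar D p w := by
  have := le_iSup₂ (f := fun (Q : Cube n) (_ : Q ∈ D.cubes) =>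
    (⨍⁻ x in Q.toSet, ENNReal.ofReal (w x) ∂volume) *
    (⨍⁻ x in Q.toSet, ENNReal.ofReal (conjWeight p w x) ∂volume) ^ (p - 1)) Q hQ
  simp only [setLAverage_eq, ← weightMeasure_apply] at this
  refine this.trans (le_of_eq ?_)
  simp only [apChar, setLAverage_eq, ← weightMeasure_apply]

include hp

lemma volume_le_weightMeasure (hw : IsWeight w) (E : Set (Fin n → ℝ)) :
    volume E ≤ weightMeasure w E ^ (1 / p) *
      weightMeasure (conjWeight p w) E ^ (1 / p.conjExponent) := by
  refine le_trans (le_of_eq ?_) (setLIntegral_rpow_mul_rpow_le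
    (Real.HolderConjugate.conjExponent hp) hw.aemeasurable (aemeasurable_conjWeight hw p) hw.2
    (ae_conjWeight_pos hw p) E)
  rw [← setLIntegral_one]
  refine lintegral_congr_ae ?_
  filter_upwards [ae_restrict_of_ae hw.2] with x hx
  rw [conjWeight_rpow hp hx, ← Real.rpow_add hx, add_neg_cancel, Real.rpow_zero, ENNReal.ofReal_one]

lemma IsApWeight.weightMeasure_conjWeight_ne_top (hw : IsApWeight D p w) {Q : Cube n}
    (hQ : Q ∈ D.cubes) : weightMeasure (conjWeight p w) Q.toSet ≠ ∞ := by
  intro h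
  have h1 := le_apChar (p := p) (w := w) hQ
  have hp1 : 0 < p - 1 := sub_pos.2 hp
  rw [h, ENNReal.top_div_of_ne_top Q.volume_ne_top, ENNReal.top_rpow_of_pos hp1,
    ENNReal.mul_top (ENNReal.div_ne_zero.2
      ⟨weightMeasure_ne_zero hw.1.aemeasurable hw.1.2 Q, Q.volume_ne_top⟩)] at h1
  exact (h1.trans_lt hw.2).ne rfl

end Ap

/-- The part of the estimate that involves one weight. Hölder's inequality on the large subset `E`
of a cube bounds `σ(E)` from below, and the characteristic enters once through this bound and once
through the averages over the cube. -/
lemma mul_rpow_div_le {p q : ℝ} (hpq : p.HolderConjugate q) {V m s sE a : ℝ} (hV : 0 < V)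
    (hm : 0 < m) (hs : 0 ≤ s) (hsE : 0 ≤ sE) (h1 : V ≤ 2 * (m ^ (1 / p) * sE ^ (1 / q)))
    (h2 : m / V * (s / V) ^ (p - 1) ≤ a) :
    s * m ^ (1 / p) / V ≤ 2 ^ (1 / (p - 1)) * a ^ (1 / (p - 1)) * sE ^ (1 / p) := by
  have hp := hpq.pos
  have hq := hpq.symm.pos
  have hp1 : 0 < p - 1 := sub_pos.2 hpq.lt
  set r := 1 / (p - 1) with hr
  have hr0 : 0 < r := by positivity
  have hqr : 1 / q * r = 1 / p := by
    rw [hr, hpq.conjugate_eq]; field_simp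
  have e1 : sE ^ (1 / p) = (sE ^ (1 / q)) ^ r := by rw [← Real.rpow_mul hsE, hqr]
  have h3 : V / (2 * m ^ (1 / p)) ≤ sE ^ (1 / q) := by
    rw [div_le_iff₀ (by positivity)]; linarith
  have h4 : (V / (2 * m ^ (1 / p))) ^ r ≤ sE ^ (1 / p) := by
    rw [e1]; exact Real.rpow_le_rpow (by positivity) h3 hr0.le
  have h5 : (m / V) ^ r * (s / V) ≤ a ^ r := by
    have := Real.rpow_le_rpow (by positivity) h2 hr0.le
    rwa [Real.mul_rpow (by positivity) (by positivity), ← Real.rpow_mul (by positivity),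
      show (p - 1) * r = 1 by rw [hr]; field_simp, Real.rpow_one] at this
  have e2 : (m / V) ^ r * (V / (2 * m ^ (1 / p))) ^ r * 2 ^ r = m ^ (1 / p) := by
    rw [← Real.mul_rpow (by positivity) (by positivity),
      ← Real.mul_rpow (by positivity) (by positivity)]
    have : m / V * (V / (2 * m ^ (1 / p))) * 2 = m ^ (1 / q) := by
      have hmm : m = m ^ (1 / p) * m ^ (1 / q) := by
        rw [← Real.rpow_add hm]
        have := hpq.inv_add_inv_eq_one
        rw [one_div, one_div, this, Real.rpow_one]
      have hmp : 0 < m ^ (1 / p) := by positivity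
      field_simp
      exact hmm
    rw [this, ← Real.rpow_mul hm.le, hqr]
  calc s * m ^ (1 / p) / V
      = s / V * m ^ (1 / p) := by ring
    _ = s / V * ((m / V) ^ r * (V / (2 * m ^ (1 / p))) ^ r * 2 ^ r) := by rw [e2]
    _ = 2 ^ r * ((m / V) ^ r * (s / V)) * (V / (2 * m ^ (1 / p))) ^ r := by ring
    _ ≤ 2 ^ r * a ^ r * sE ^ (1 / p) := by
        have : 0 ≤ a := le_trans (by positivity) h2
        gcongr

/-- The form of `mul_rpow_div_le` for the conjugate exponent, with the characteristic in terms of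
the exponent `p`. -/
lemma mul_rpow_div_le' {p q : ℝ} (hpq : p.HolderConjugate q) {V l l' lE a : ℝ} (hV : 0 < V)
    (hl' : 0 < l') (hl : 0 ≤ l) (hlE : 0 ≤ lE) (h1 : V ≤ 2 * (lE ^ (1 / p) * l' ^ (1 / q)))
    (h2 : l / V * (l' / V) ^ (p - 1) ≤ a) :
    l * l' ^ (1 / q) / V ≤ 2 ^ (p - 1) * a * lE ^ (1 / q) := by
  have hp1 : 0 < p - 1 := sub_pos.2 hpq.lt
  have hq1 : 0 < q - 1 := sub_pos.2 hpq.symm.lt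
  have hpq1 : (p - 1) * (q - 1) = 1 := by
    rw [hpq.conjugate_eq]; field_simp; ring
  have ha : 0 ≤ a := le_trans (by positivity) h2
  have e : 1 / (q - 1) = p - 1 := by rw [div_eq_iff hq1.ne', hpq1]
  have := mul_rpow_div_le hpq.symm hV hl' hl hlE (by rwa [mul_comm (l' ^ _)]) (a := a ^ (q - 1)) (by
    have h3 := Real.rpow_le_rpow (by positivity) h2 hq1.le
    rwa [Real.mul_rpow (by positivity) (by positivity), ← Real.rpow_mul (by positivity), hpq1,
      Real.rpow_one, mul_comm] at h3)
  rwa [e, ← Real.rpow_mul ha, mul_comm (q - 1), hpq1, Real.rpow_one] at this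

lemma rpow_mul_rpow_add_le {p q : ℝ} (hpq : p.HolderConjugate q) {a b c d : ℝ} (ha : 0 ≤ a)
    (hb : 0 ≤ b) (hc : 0 ≤ c) (hd : 0 ≤ d) :
    a ^ (1 / p) * b ^ (1 / q) + c ^ (1 / p) * d ^ (1 / q) ≤
      (a + c) ^ (1 / p) * (b + d) ^ (1 / q) := by
  have hp := hpq.pos
  have hq := hpq.symm.pos
  have := Real.inner_le_Lp_mul_Lq_of_nonneg (Finset.univ : Finset (Fin 2)) hpq
    (f := ![a ^ (1 / p), c ^ (1 / p)]) (g := ![b ^ (1 / q), d ^ (1 / q)])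
    (by intro i _; fin_cases i <;> simp <;> positivity)
    (by intro i _; fin_cases i <;> simp <;> positivity)
  simp only [Fin.sum_univ_two, Matrix.cons_val_zero, Matrix.cons_val_one] at this
  rwa [← Real.rpow_mul ha, ← Real.rpow_mul hb, ← Real.rpow_mul hc, ← Real.rpow_mul hd,
    one_div_mul_cancel hp.ne', one_div_mul_cancel hq.ne', Real.rpow_one, Real.rpow_one,
    Real.rpow_one, Real.rpow_one] at this

/-- Every finite family of cubes of a grid is contained in a finite family that is closed under
passage to smaller cubes of the grid down to some scale. -/
lemma DyadicGrid.exists_closed_superset (hn : 0 < n) (D : DyadicGrid n) {F : Finset (Cube n)}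
    (hF : ∀ Q ∈ F, Q ∈ D.cubes) :
    ∃ (F' : Finset (Cube n)) (s : ℤ), F ⊆ F' ∧ (∀ Q ∈ F', Q ∈ D.cubes) ∧ (∀ Q ∈ F', s ≤ Q.scale) ∧
      ∀ Q ∈ F', ∀ S ∈ D.cubes, S.toSet ⊆ Q.toSet → s ≤ S.scale → S ∈ F' := by
  obtain ⟨s, hs⟩ : ∃ s : ℤ, ∀ Q ∈ F, s ≤ Q.scale := by
    obtain ⟨s, hs⟩ := (F.finite_toSet.image Cube.scale).bddBelow
    exact ⟨s, fun Q hQ => hs ⟨Q, hQ, rfl⟩⟩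
  have hfin : (⋃ Q ∈ F, {R | R ∈ D.cubes ∧ R.toSet ⊆ Q.toSet ∧ s ≤ R.scale}).Finite :=
    F.finite_toSet.biUnion fun Q hQ => D.finite_descendants hn (hF Q hQ) s
  refine ⟨hfin.toFinset, s, fun Q hQ => ?_, fun Q hQ => ?_, fun Q hQ => ?_,
    fun Q hQ S hS hSQ hsS => ?_⟩
  · simp only [Set.Finite.mem_toFinset, Set.mem_iUnion]
    exact ⟨Q, hQ, hF Q hQ, subset_rfl, hs Q hQ⟩
  all_goals
    simp only [Set.Finite.mem_toFinset, Set.mem_iUnion] at hQ ⊢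
    obtain ⟨R, hR, h1, h2, h3⟩ := hQ
  exacts [h1, h3, ⟨R, hR, hS, hSQ.trans h2, hsS⟩]

end Weights

/-! ### The weighted estimate of the form -/

section WeightedForm

variable {n : ℕ}

variable {D : DyadicGrid n} {p : ℝ} {mu lam b : (Fin n → ℝ) → ℝ}

/-- The constant in the estimate of the form: the product of the `BMO` norm and of the powers of
the characteristics. -/
def bloomConst (D : DyadicGrid n) (p : ℝ) (mu lam b : (Fin n → ℝ) → ℝ) : ℝ :=
  (bmoNorm D (bloomWeight p mu lam) b).toReal * (apChar D p mu).toReal ^ (1 / (p - 1)) *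
    (apChar D p lam).toReal

section Testing

variable (hp : 1 < p) (hmu : IsApWeight D p mu)
  (hlam : IsApWeight D p lam) (hb : MemBMO D (bloomWeight p mu lam) b)

lemma IsApWeight.toReal_le {w : (Fin n → ℝ) → ℝ} (hw : IsApWeight D p w) {Q : Cube n}
    (hQ : Q ∈ D.cubes) :
    (weightMeasure w).real Q.toSet / Q.vol *
      ((weightMeasure (conjWeight p w)).real Q.toSet / Q.vol) ^ (p - 1) ≤
      (apChar D p w).toReal := by
  have := ENNReal.toReal_mono hw.2.ne (le_apChar (p := p) (w := w) hQ)
  simpa only [ENNReal.toReal_mul, ENNReal.toReal_div, ← ENNReal.toReal_rpow, measureReal_def,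
    Cube.vol] using this

include hp

lemma IsApWeight.volume_real_le {w : (Fin n → ℝ) → ℝ} (hw : IsApWeight D p w) {Q : Cube n}
    (hQ : Q ∈ D.cubes) {E : Set (Fin n → ℝ)} (hE : E ⊆ Q.toSet) :
    volume.real E ≤ (weightMeasure w).real E ^ (1 / p) *
      (weightMeasure (conjWeight p w)).real E ^ (1 / p.conjExponent) := by
  have hpq := Real.HolderConjugate.conjExponent hp
  have hp0 := hpq.pos
  have hq0 := hpq.symm.pos
  have := ENNReal.toReal_mono (ENNReal.mul_ne_top
    (ENNReal.rpow_ne_top_of_nonneg (by positivity)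
      (measure_ne_top_of_subset hE (weightMeasure_ne_top hw.1 Q)))
    (ENNReal.rpow_ne_top_of_nonneg (by positivity)
      (measure_ne_top_of_subset hE (hw.weightMeasure_conjWeight_ne_top hp hQ))))
    (volume_le_weightMeasure hp hw.1 E)
  simpa only [ENNReal.toReal_mul, ← ENNReal.toReal_rpow, measureReal_def] using this

include hmu hlam hb

/-- The oscillation of `b` over a cube, estimated by the `BMO` norm and Hölder's inequality for
`ν = μ^{1/p} (λ')^{1/p'}`. -/
lemma integral_oscillation_le {Q : Cube n} (hQ : Q ∈ D.cubes) :
    ∫ x in Q.toSet, |b x - avg b Q| ≤ (bmoNorm D (bloomWeight p mu lam) b).toReal *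
      ((weightMeasure mu).real Q.toSet ^ (1 / p) *
        (weightMeasure (conjWeight p lam)).real Q.toSet ^ (1 / p.conjExponent)) := by
  have hpq := Real.HolderConjugate.conjExponent hp
  have hp0 := hpq.pos
  have hq0 := hpq.symm.pos
  set ν := bloomWeight p mu lam with hν
  have hνm : AEMeasurable ν :=
    (hmu.1.aemeasurable.pow_const _).mul (hlam.1.aemeasurable.pow_const _)
  have hνpos : ∀ᵐ x, 0 < ν x := by
    filter_upwards [hmu.1.2, hlam.1.2] with x hx hy
    exact mul_pos (Real.rpow_pos_of_pos hx _) (Real.rpow_pos_of_pos hy _)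
  have hνle : weightMeasure ν Q.toSet ≤ weightMeasure mu Q.toSet ^ (1 / p) *
      weightMeasure (conjWeight p lam) Q.toSet ^ (1 / p.conjExponent) := by
    refine le_trans (le_of_eq ?_) (setLIntegral_rpow_mul_rpow_le hpq hmu.1.aemeasurable
      (aemeasurable_conjWeight hlam.1 p) hmu.1.2 (ae_conjWeight_pos hlam.1 p) Q.toSet)
    rw [weightMeasure_apply]
    refine lintegral_congr_ae ?_
    filter_upwards [ae_restrict_of_ae hlam.1.2] with x hx
    rw [conjWeight_rpow hp hx, hν, bloomWeight]
  have hfin : weightMeasure mu Q.toSet ^ (1 / p) *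
      weightMeasure (conjWeight p lam) Q.toSet ^ (1 / p.conjExponent) ≠ ∞ :=
    ENNReal.mul_ne_top
      (ENNReal.rpow_ne_top_of_nonneg (by positivity) (weightMeasure_ne_top hmu.1 Q))
      (ENNReal.rpow_ne_top_of_nonneg (by positivity) (hlam.weightMeasure_conjWeight_ne_top hp hQ))
  have h1 : (∫⁻ x in Q.toSet, ‖b x - avg b Q‖ₑ) / weightMeasure ν Q.toSet ≤ bmoNorm D ν b :=
    le_iSup₂ (f := fun (Q : Cube n) (_ : Q ∈ D.cubes) =>
      (∫⁻ x in Q.toSet, ‖b x - avg b Q‖ₑ) / weightMeasure ν Q.toSet) Q hQ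
  rw [ENNReal.div_le_iff (weightMeasure_ne_zero hνm hνpos Q) (hνle.trans_lt hfin.lt_top).ne] at h1
  have h2 := ENNReal.toReal_mono (ENNReal.mul_ne_top hb.2.ne hfin)
    (h1.trans (mul_le_mul_right hνle _))
  have hbint : IntegrableOn (fun x => b x - avg b Q) Q.toSet :=
    (Q.integrableOn hb.1).sub (integrableOn_const Q.volume_ne_top)
  have h3 : ∫ x in Q.toSet, |b x - avg b Q| = (∫⁻ x in Q.toSet, ‖b x - avg b Q‖ₑ).toReal :=
    integral_norm_eq_lintegral_enorm hbint.aestronglyMeasurable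
  rw [h3]
  simpa only [ENNReal.toReal_mul, ← ENNReal.toReal_rpow, measureReal_def] using h2

/-- The estimate for one cube `Q` and a large subset `E`, where `X` and `Y` are the averages of `f`
and `g` with respect to `σ = μ'` and `λ`. -/
lemma testing_le {Q : Cube n} (hQ : Q ∈ D.cubes) {E : Set (Fin n → ℝ)} (hE : E ⊆ Q.toSet)
    (hvol : Q.vol ≤ 2 * volume.real E) {X Y : ℝ} (hX : 0 ≤ X) (hY : 0 ≤ Y) :
    (X * (weightMeasure (conjWeight p mu)).real Q.toSet / Q.vol) *
      (Y * (weightMeasure lam).real Q.toSet / Q.vol) * ∫ x in Q.toSet, |b x - avg b Q| ≤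
    2 ^ (1 / (p - 1)) * 2 ^ (p - 1) * bloomConst D p mu lam b *
      ((X * (weightMeasure (conjWeight p mu)).real E ^ (1 / p)) *
        (Y * (weightMeasure lam).real E ^ (1 / p.conjExponent))) := by
  have hpq := Real.HolderConjugate.conjExponent hp
  have hp0 := hpq.pos
  have hq0 := hpq.symm.pos
  have hV := Q.vol_pos
  have hm : 0 < (weightMeasure mu).real Q.toSet :=
    ENNReal.toReal_pos (weightMeasure_ne_zero hmu.1.aemeasurable hmu.1.2 Q)
      (weightMeasure_ne_top hmu.1 Q)
  have hl' : 0 < (weightMeasure (conjWeight p lam)).real Q.toSet :=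
    ENNReal.toReal_pos (weightMeasure_ne_zero (aemeasurable_conjWeight hlam.1 p)
      (ae_conjWeight_pos hlam.1 p) Q) (hlam.weightMeasure_conjWeight_ne_top hp hQ)
  have hmE : (weightMeasure mu).real E ≤ (weightMeasure mu).real Q.toSet :=
    measureReal_mono hE (weightMeasure_ne_top hmu.1 Q)
  have hlE : (weightMeasure (conjWeight p lam)).real E ≤
      (weightMeasure (conjWeight p lam)).real Q.toSet :=
    measureReal_mono hE (hlam.weightMeasure_conjWeight_ne_top hp hQ)
  have k1 := mul_rpow_div_le hpq (m := (weightMeasure mu).real Q.toSet)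
    (s := (weightMeasure (conjWeight p mu)).real Q.toSet)
    (sE := (weightMeasure (conjWeight p mu)).real E) hV hm measureReal_nonneg measureReal_nonneg
    (hvol.trans (mul_le_mul_of_nonneg_left ((hmu.volume_real_le hp hQ hE).trans (by gcongr))
      zero_le_two)) (hmu.toReal_le hQ)
  have k2 := mul_rpow_div_le' hpq (l := (weightMeasure lam).real Q.toSet)
    (l' := (weightMeasure (conjWeight p lam)).real Q.toSet)
    (lE := (weightMeasure lam).real E) hV hl' measureReal_nonneg measureReal_nonneg
    (hvol.trans (mul_le_mul_of_nonneg_left ((hlam.volume_real_le hp hQ hE).trans (by gcongr))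
      zero_le_two)) (hlam.toReal_le hQ)
  have k3 := integral_oscillation_le hp hmu hlam hb hQ
  set m := (weightMeasure mu).real Q.toSet
  set s := (weightMeasure (conjWeight p mu)).real Q.toSet
  set sE := (weightMeasure (conjWeight p mu)).real E
  set l := (weightMeasure lam).real Q.toSet
  set lE := (weightMeasure lam).real E
  set l' := (weightMeasure (conjWeight p lam)).real Q.toSet
  set q := p.conjExponent
  have hs : 0 ≤ s := measureReal_nonneg
  have hl : 0 ≤ l := measureReal_nonneg
  set β := (bmoNorm D (bloomWeight p mu lam) b).toReal
  have hβ : 0 ≤ β := ENNReal.toReal_nonneg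
  have hsE : 0 ≤ sE := measureReal_nonneg
  have hlE0 : 0 ≤ lE := measureReal_nonneg
  have ha1 : 0 ≤ (apChar D p mu).toReal := ENNReal.toReal_nonneg
  calc _ ≤ (X * s / Q.vol) * (Y * l / Q.vol) * (β * (m ^ (1 / p) * l' ^ (1 / q))) := by gcongr
    _ = X * Y * β * ((s * m ^ (1 / p) / Q.vol) * (l * l' ^ (1 / q) / Q.vol)) := by ring
    _ ≤ X * Y * β * ((2 ^ (1 / (p - 1)) * (apChar D p mu).toReal ^ (1 / (p - 1)) * sE ^ (1 / p)) *
        (2 ^ (p - 1) * (apChar D p lam).toReal * lE ^ (1 / q))) := by gcongr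
    _ = _ := by rw [bloomConst]; ring

end Testing

/-- The average of `|f₀ w|`, written as the average of `f₀` with respect to the measure `w dx`. -/
lemma avg_abs_mul_eq {w f₀ : (Fin n → ℝ) → ℝ} (hw : AEMeasurable w) (hw0 : ∀ᵐ x, 0 < w x)
    (hf : LocallyIntegrable fun x => f₀ x * w x) {Q : Cube n}
    (hQ : weightMeasure w Q.toSet ≠ ∞) :
    avg (fun x => |f₀ x * w x|) Q =
      ((∫⁻ x in Q.toSet, ‖f₀ x‖ₑ ∂weightMeasure w) / weightMeasure w Q.toSet).toReal *
        (weightMeasure w).real Q.toSet / Q.vol := by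
  have h0 := weightMeasure_ne_zero hw hw0 Q
  have h1 : (weightMeasure w).real Q.toSet ≠ 0 := (ENNReal.toReal_pos h0 hQ).ne'
  rw [avg_eq, ENNReal.toReal_div, ← measureReal_def, div_mul_cancel₀ _ h1]
  congr 1
  rw [weightMeasure, setLIntegral_withDensity_eq_setLIntegral_mul_non_measurable₀' _ _
    hw.restrict.ennreal_ofReal _ (.of_forall fun _ => ENNReal.ofReal_lt_top)]
  refine (integral_norm_eq_lintegral_enorm (Q.integrableOn hf).aestronglyMeasurable).trans ?_
  congr 1
  refine lintegral_congr_ae ?_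
  filter_upwards [ae_restrict_of_ae hw0] with x hx
  rw [Pi.mul_apply, enorm_mul, mul_comm, Real.enorm_of_nonneg hx.le]

lemma setLIntegral_enorm_ne_top {w f₀ : (Fin n → ℝ) → ℝ} (hw : AEMeasurable w)
    (hw0 : ∀ᵐ x, 0 < w x) (hf : LocallyIntegrable fun x => f₀ x * w x) (Q : Cube n) :
    ∫⁻ x in Q.toSet, ‖f₀ x‖ₑ ∂weightMeasure w ≠ ∞ := by
  rw [weightMeasure, setLIntegral_withDensity_eq_setLIntegral_mul_non_measurable₀' _ _
    hw.restrict.ennreal_ofReal _ (.of_forall fun _ => ENNReal.ofReal_lt_top)]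
  refine ne_of_eq_of_ne ?_ (Q.integrableOn hf).2.ne
  refine lintegral_congr_ae ?_
  filter_upwards [ae_restrict_of_ae hw0] with x hx
  rw [Pi.mul_apply, enorm_mul, mul_comm, Real.enorm_of_nonneg hx.le]

lemma toReal_div_mul_rpow_le {ρ : Measure (Fin n → ℝ)} {h : (Fin n → ℝ) → ℝ≥0∞}
    {F : Finset (Cube n)} {p : ℝ} (hp : 0 < p) (hfin : ∫⁻ x, maxFun ρ h F x ^ p ∂ρ ≠ ∞)
    {Q : Cube n} (hQ : Q ∈ F) {E : Set (Fin n → ℝ)} (hE : E ⊆ Q.toSet) (hEm : MeasurableSet E) :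
    ((∫⁻ x in Q.toSet, h x ∂ρ) / ρ Q.toSet).toReal * ρ.real E ^ (1 / p) ≤
      (∫⁻ x in E, maxFun ρ h F x ^ p ∂ρ).toReal ^ (1 / p) := by
  set X := (∫⁻ x in Q.toSet, h x ∂ρ) / ρ Q.toSet with hX
  have h1 : X ^ p * ρ E ≤ ∫⁻ x in E, maxFun ρ h F x ^ p ∂ρ := by
    rw [← setLIntegral_const]
    exact setLIntegral_mono' hEm fun x hx =>
      ENNReal.rpow_le_rpow (le_maxFun hQ (hE hx)) hp.le
  have h2 := ENNReal.toReal_mono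
    (ne_top_of_le_ne_top hfin (setLIntegral_le_lintegral E _)) h1
  rw [ENNReal.toReal_mul, ← ENNReal.toReal_rpow, ← measureReal_def] at h2
  have h3 := Real.rpow_le_rpow (by positivity) h2 (one_div_nonneg.2 hp.le)
  rwa [Real.mul_rpow (by positivity) (by positivity), ← Real.rpow_mul ENNReal.toReal_nonneg,
    mul_one_div_cancel hp.ne', Real.rpow_one] at h3

/-- The constant in the weighted estimate of the form. -/
def formConst (n : ℕ) (p : ℝ) : ℝ :=
  216 * 4 ^ n * (2 ^ (1 / (p - 1)) * 2 ^ (p - 1) * (p.conjExponent * p))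

/-- The weighted estimate of the form, for functions `f = f₀ σ` and `g = g₀ λ` with `σ = μ'`, in
both orders of `f` and `g`. -/
theorem sum_formTerm_weighted_le (hn : 0 < n) (hp : 1 < p) (hmu : IsApWeight D p mu)
    (hlam : IsApWeight D p lam) (hb : MemBMO D (bloomWeight p mu lam) b) {F : Finset (Cube n)}
    (hF : ∀ Q ∈ F, Q ∈ D.cubes) {f₀ g₀ : (Fin n → ℝ) → ℝ}
    (hf₀ : AEMeasurable f₀ (weightMeasure (conjWeight p mu)))
    (hg₀ : AEMeasurable g₀ (weightMeasure lam))
    (hf : LocallyIntegrable fun x => f₀ x * conjWeight p mu x)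
    (hg : LocallyIntegrable fun x => g₀ x * lam x)
    (hf_fin : ∫⁻ x, ‖f₀ x‖ₑ ^ p ∂weightMeasure (conjWeight p mu) ≠ ∞)
    (hg_fin : ∫⁻ x, ‖g₀ x‖ₑ ^ p.conjExponent ∂weightMeasure lam ≠ ∞)
    {ε θ : Fin n → Bool} (hε : ε ∈ cancellative n) (hθ : θ ∈ cancellative n) :
    ∑ Q ∈ F, formTerm b (fun x => f₀ x * conjWeight p mu x) (fun x => g₀ x * lam x) ε θ Q ≤
      formConst n p * bloomConst D p mu lam b *
        ((∫⁻ x, ‖f₀ x‖ₑ ^ p ∂weightMeasure (conjWeight p mu)).toReal ^ (1 / p) *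
          (∫⁻ x, ‖g₀ x‖ₑ ^ p.conjExponent ∂weightMeasure lam).toReal ^ (1 / p.conjExponent)) ∧
    ∑ Q ∈ F, formTerm b (fun x => g₀ x * lam x) (fun x => f₀ x * conjWeight p mu x) ε θ Q ≤
      formConst n p * bloomConst D p mu lam b *
        ((∫⁻ x, ‖f₀ x‖ₑ ^ p ∂weightMeasure (conjWeight p mu)).toReal ^ (1 / p) *
          (∫⁻ x, ‖g₀ x‖ₑ ^ p.conjExponent ∂weightMeasure lam).toReal ^ (1 / p.conjExponent)) := by
  have hpq := Real.HolderConjugate.conjExponent hp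
  set q := p.conjExponent with hq
  have hp0 := hpq.pos
  have hq0 := hpq.symm.pos
  obtain ⟨F', s, hFF', hF'D, hF's, hF'c⟩ := D.exists_closed_superset hn hF
  set σ := conjWeight p mu with hσ
  have hσm : AEMeasurable σ := aemeasurable_conjWeight hmu.1 p
  have hσ0 : ∀ᵐ x, 0 < σ x := ae_conjWeight_pos hmu.1 p
  set f : (Fin n → ℝ) → ℝ := fun x => f₀ x * σ x with hfdef
  set g : (Fin n → ℝ) → ℝ := fun x => g₀ x * lam x with hgdef
  set u := maxFun (weightMeasure σ) (fun x => ‖f₀ x‖ₑ) F' with hu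
  set v := maxFun (weightMeasure lam) (fun x => ‖g₀ x‖ₑ) F' with hv
  have hσQ : ∀ Q ∈ F', weightMeasure σ Q.toSet ≠ ∞ := fun Q hQ =>
    hmu.weightMeasure_conjWeight_ne_top hp (hF'D Q hQ)
  have hlQ : ∀ Q ∈ F', weightMeasure lam Q.toSet ≠ ∞ := fun Q _ => weightMeasure_ne_top hlam.1 Q
  have hfQ : ∀ Q ∈ F', ∫⁻ x in Q.toSet, ‖f₀ x‖ₑ ∂weightMeasure σ ≠ ∞ := fun Q _ =>
    setLIntegral_enorm_ne_top hσm hσ0 hf Q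
  have hgQ : ∀ Q ∈ F', ∫⁻ x in Q.toSet, ‖g₀ x‖ₑ ∂weightMeasure lam ≠ ∞ := fun Q _ =>
    setLIntegral_enorm_ne_top hlam.1.aemeasurable hlam.1.2 hg Q
  have hu_fin := (lintegral_maxFun_rpow_le hn hpq F' hF'D hσQ hfQ).1
  have hv_fin := (lintegral_maxFun_rpow_le hn hpq.symm F' hF'D hlQ hgQ).1
  have hu_le := lintegral_maxFun_rpow_le_lintegral_rpow hn hpq F' hF'D hσQ hfQ hf₀.enorm
  have hv_le := lintegral_maxFun_rpow_le_lintegral_rpow hn hpq.symm F' hF'D hlQ hgQ hg₀.enorm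
  set K := 2 ^ (1 / (p - 1)) * 2 ^ (p - 1) * bloomConst D p mu lam b with hK
  have hB0 : 0 ≤ bloomConst D p mu lam b := by
    unfold bloomConst; positivity
  have hK0 : 0 ≤ K := by positivity
  set H : Set (Fin n → ℝ) → ℝ := fun E => K *
    ((∫⁻ x in E, u x ^ p ∂weightMeasure σ).toReal ^ (1 / p) *
      (∫⁻ x in E, v x ^ q ∂weightMeasure lam).toReal ^ (1 / q)) with hH
  have H0 : ∀ E, 0 ≤ H E := fun E => by positivity
  have Hadd : ∀ E₁ E₂, MeasurableSet E₁ → MeasurableSet E₂ → Disjoint E₁ E₂ →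
      H E₁ + H E₂ ≤ H (E₁ ∪ E₂) := by
    intro E₁ E₂ _ h2 hd
    simp only [hH]
    rw [← mul_add, lintegral_union h2 hd, lintegral_union h2 hd, ENNReal.toReal_add, ENNReal.toReal_add]
    · exact mul_le_mul_of_nonneg_left (rpow_mul_rpow_add_le hpq ENNReal.toReal_nonneg
        ENNReal.toReal_nonneg ENNReal.toReal_nonneg ENNReal.toReal_nonneg) hK0
    all_goals first
      | exact ne_top_of_le_ne_top hu_fin (setLIntegral_le_lintegral _ _)
      | exact ne_top_of_le_ne_top hv_fin (setLIntegral_le_lintegral _ _)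
  have htest : ∀ S ∈ F', ∀ E ⊆ S.toSet, MeasurableSet E → S.vol ≤ 2 * volume.real E →
      avg (fun x => |f x|) S * avg (fun x => |g x|) S * ∫ x in S.toSet, |b x - avg b S| ≤ H E := by
    intro S hS E hE hEm hvol
    have ht := testing_le hp hmu hlam hb (hF'D S hS) hE hvol
      (X := ((∫⁻ x in S.toSet, ‖f₀ x‖ₑ ∂weightMeasure σ) / weightMeasure σ S.toSet).toReal)
      (Y := ((∫⁻ x in S.toSet, ‖g₀ x‖ₑ ∂weightMeasure lam) / weightMeasure lam S.toSet).toReal)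
      ENNReal.toReal_nonneg ENNReal.toReal_nonneg
    rw [← hσ, ← avg_abs_mul_eq hσm hσ0 hf (hσQ S hS),
      ← avg_abs_mul_eq hlam.1.aemeasurable hlam.1.2 hg (hlQ S hS)] at ht
    refine ht.trans (mul_le_mul_of_nonneg_left ?_ hK0)
    exact mul_le_mul (toReal_div_mul_rpow_le hp0 hu_fin hS hE hEm)
      (toReal_div_mul_rpow_le hq0 hv_fin hS hE hEm) (by positivity) (by positivity)
  have hfinal : 216 * 4 ^ n * H Set.univ ≤ formConst n p * bloomConst D p mu lam b *
        ((∫⁻ x, ‖f₀ x‖ₑ ^ p ∂weightMeasure σ).toReal ^ (1 / p) *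
          (∫⁻ x, ‖g₀ x‖ₑ ^ q ∂weightMeasure lam).toReal ^ (1 / q)) := by
    have e1 := ENNReal.toReal_mono (ENNReal.mul_ne_top ENNReal.ofReal_ne_top
      (ENNReal.rpow_ne_top_of_nonneg (by positivity) hf_fin)) hu_le
    have e2 := ENNReal.toReal_mono (ENNReal.mul_ne_top ENNReal.ofReal_ne_top
      (ENNReal.rpow_ne_top_of_nonneg (by positivity) hg_fin)) hv_le
    rw [ENNReal.toReal_mul, ← ENNReal.toReal_rpow, ← ENNReal.toReal_rpow,
      ENNReal.toReal_ofReal hq0.le] at e1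
    rw [ENNReal.toReal_mul, ← ENNReal.toReal_rpow, ← ENNReal.toReal_rpow,
      ENNReal.toReal_ofReal hp0.le] at e2
    simp only [hH, Measure.restrict_univ]
    calc _ ≤ 216 * 4 ^ n * (K * ((q * (∫⁻ x, ‖f₀ x‖ₑ ^ p ∂weightMeasure σ).toReal ^ (1 / p)) *
          (p * (∫⁻ x, ‖g₀ x‖ₑ ^ q ∂weightMeasure lam).toReal ^ (1 / q)))) := by gcongr
      _ = _ := by rw [hK, formConst]; ring
  have hsub : ∀ φ ψ : (Fin n → ℝ) → ℝ,
      ∑ Q ∈ F, formTerm b φ ψ ε θ Q ≤ ∑ Q ∈ F', formTerm b φ ψ ε θ Q := fun φ ψ =>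
    Finset.sum_le_sum_of_subset_of_nonneg hFF' fun Q _ _ => formTerm_nonneg _ _ _ _ _ Q
  constructor
  · exact (hsub f g).trans ((sum_formTerm_le hn hF'D hF's hb.1 hf hg hε hθ H0 Hadd hF'c
      htest).trans hfinal)
  · refine (hsub g f).trans ((sum_formTerm_le hn hF'D hF's hb.1 hg hf hε hθ H0 Hadd hF'c
      fun S hS E hE hEm hvol => ?_).trans hfinal)
    rw [mul_comm (avg _ S)]
    exact htest S hS E hE hEm hvol

end WeightedForm

/-! ### Unconditional convergence in `L^p` -/

section UnconditionalSeries

section Khintchine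

variable {ι : Type*} [DecidableEq ι]

/-- The sum over `t` of the numbers `a j`, with the sign `+` for `j ∈ S` and `-` otherwise. -/
def signSum (t : Finset ι) (a : ι → ℝ) (S : Finset ι) : ℝ :=
  ∑ j ∈ t, if j ∈ S then a j else -a j

lemma sum_powerset_insert_signSum {t : Finset ι} {i : ι} (hi : i ∉ t) (a : ι → ℝ) (φ : ℝ → ℝ) :
    ∑ S ∈ (insert i t).powerset, φ (signSum (insert i t) a S) =
      ∑ S ∈ t.powerset, φ (-a i + signSum t a S) + ∑ S ∈ t.powerset, φ (a i + signSum t a S) := by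
  rw [Finset.sum_powerset_insert hi]
  congr 1 <;> refine Finset.sum_congr rfl fun S hS => ?_
  · rw [signSum, Finset.sum_insert hi, if_neg fun h => hi (Finset.mem_powerset.1 hS h)]; rfl
  · rw [signSum, Finset.sum_insert hi, if_pos (Finset.mem_insert_self _ _)]
    congr 2
    refine Finset.sum_congr rfl fun j hj => ?_
    have : j ≠ i := fun h => hi (h ▸ hj)
    simp [this]

lemma sum_add_signSum_sq (t : Finset ι) (a : ι → ℝ) (c : ℝ) :
    ∑ S ∈ t.powerset, (c + signSum t a S) ^ 2 = 2 ^ t.card * (c ^ 2 + ∑ j ∈ t, a j ^ 2) := by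
  induction t using Finset.induction_on generalizing c with
  | empty => simp [signSum]
  | insert i t hi ih =>
    rw [sum_powerset_insert_signSum hi a fun y => (c + y) ^ 2, Finset.sum_insert hi,
      Finset.card_insert_of_notMem hi]
    simp only [← add_assoc, ih]
    ring

lemma sum_add_signSum_pow_four_le (t : Finset ι) (a : ι → ℝ) (c : ℝ) :
    ∑ S ∈ t.powerset, (c + signSum t a S) ^ 4 ≤ 2 ^ t.card *
      (c ^ 4 + 6 * c ^ 2 * (∑ j ∈ t, a j ^ 2) + 3 * (∑ j ∈ t, a j ^ 2) ^ 2) := by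
  induction t using Finset.induction_on generalizing c with
  | empty => simp [signSum]
  | insert i t hi ih =>
    rw [sum_powerset_insert_signSum hi a fun y => (c + y) ^ 4, Finset.sum_insert hi,
      Finset.card_insert_of_notMem hi]
    simp only [← add_assoc]
    refine (add_le_add (ih _) (ih _)).trans ?_
    rw [pow_succ (2 : ℝ) t.card, ← mul_add, mul_assoc ((2 : ℝ) ^ t.card)]
    refine mul_le_mul_of_nonneg_left ?_ (pow_nonneg zero_le_two _)
    nlinarith [sq_nonneg (a i ^ 2)]

/-- Khintchine's inequality in `L^1`, by comparison of the second and the fourth moment. -/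
lemma sqrt_sum_sq_le (t : Finset ι) (a : ι → ℝ) :
    2 ^ t.card * √(∑ j ∈ t, a j ^ 2) ≤ 2 * ∑ S ∈ t.powerset, |signSum t a S| := by
  set τ := √(∑ j ∈ t, a j ^ 2) with hτ
  have hτ2 : τ ^ 2 = ∑ j ∈ t, a j ^ 2 := Real.sq_sqrt (Finset.sum_nonneg fun j _ => sq_nonneg _)
  have hτ0 : 0 ≤ τ := Real.sqrt_nonneg _
  obtain h0 | hpos := hτ0.eq_or_lt
  · rw [← h0, mul_zero]
    have : 0 ≤ ∑ S ∈ t.powerset, |signSum t a S| := Finset.sum_nonneg fun _ _ => abs_nonneg _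
    positivity
  have h2 := sum_add_signSum_sq t a 0
  have h4 := sum_add_signSum_pow_four_le t a 0
  simp only [zero_add, ← hτ2] at h2 h4
  have hpt : ∀ x : ℝ, 6 * τ ^ 2 * x ^ 2 - x ^ 4 ≤ 6 * τ ^ 3 * |x| := by
    intro x
    rw [← sq_abs x, show x ^ 4 = |x| ^ 4 by rw [show 4 = 2 * 2 from rfl, pow_mul, pow_mul, sq_abs]]
    have hy := abs_nonneg x
    set y := |x|
    -- `6 τ ^ 3 - 6 τ ^ 2 y + y ^ 3 ≥ 0` for `y ≥ 0`
    have : 0 ≤ 6 * τ ^ 3 - 6 * τ ^ 2 * y + y ^ 3 := by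
      nlinarith [mul_nonneg (add_nonneg hy hτ0) (sq_nonneg (y - 3 / 2 * τ)),
        mul_nonneg hτ0 (sq_nonneg (y - 3 / 2 * τ)), mul_nonneg hy (sq_nonneg (y - 3 / 2 * τ)),
        pow_pos hpos 3, mul_nonneg hy (sq_nonneg τ)]
    nlinarith [mul_nonneg hy this]
  have hsum := Finset.sum_le_sum fun S (_ : S ∈ t.powerset) => hpt (signSum t a S)
  rw [Finset.sum_sub_distrib, ← Finset.mul_sum, ← Finset.mul_sum, h2] at hsum
  have h5 : 3 * τ ^ 3 * (2 ^ t.card * τ) ≤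
      3 * τ ^ 3 * (2 * ∑ S ∈ t.powerset, |signSum t a S|) := by nlinarith
  exact le_of_mul_le_mul_left h5 (by positivity)

lemma sum_rpow_le_rpow_sum (t : Finset ι) {a : ι → ℝ} (ha : ∀ i, 0 ≤ a i) {r : ℝ} (hr : 1 ≤ r) :
    ∑ j ∈ t, a j ^ r ≤ (∑ j ∈ t, a j) ^ r := by
  induction t using Finset.induction_on with
  | empty => simp [Real.zero_rpow (by linarith : r ≠ 0)]
  | insert i t hi ih =>
    rw [Finset.sum_insert hi, Finset.sum_insert hi]
    exact (add_le_add_right ih _).trans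
      (Real.add_rpow_le_rpow_add (ha i) (Finset.sum_nonneg fun j _ => ha j) hr)

/-- The power mean over the signs grows faster than the mean of the powers, by a power of the number
of summands. -/
lemma exists_rpow_mul_sum_le {p : ℝ} (hp : 1 ≤ p) : ∃ κ : ℝ, 0 < κ ∧
    ∀ (t : Finset ι) (a : ι → ℝ), t.Nonempty → (t.card : ℝ) ^ κ * ∑ j ∈ t, |a j| ^ p ≤
      t.card * (2 ^ p / 2 ^ t.card) * ∑ S ∈ t.powerset, |signSum t a S| ^ p := by
  have hp0 : 0 < p := by linarith
  -- Khintchine's inequality in `L^p`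
  have hK : ∀ (t : Finset ι) (a : ι → ℝ), √(∑ j ∈ t, a j ^ 2) ^ p ≤
      2 ^ p / 2 ^ t.card * ∑ S ∈ t.powerset, |signSum t a S| ^ p := by
    intro t a
    have h1 : √(∑ j ∈ t, a j ^ 2) ≤ 2 / 2 ^ t.card * ∑ S ∈ t.powerset, |signSum t a S| := by
      rw [div_mul_eq_mul_div, le_div_iff₀' (by positivity)]
      exact sqrt_sum_sq_le t a
    have h2 := Real.rpow_sum_le_const_mul_sum_rpow_of_nonneg (s := t.powerset)
      (f := fun S => |signSum t a S|) hp fun _ _ => abs_nonneg _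
    rw [Finset.card_powerset] at h2
    push_cast at h2
    refine (Real.rpow_le_rpow (Real.sqrt_nonneg _) h1 hp0.le).trans ?_
    rw [Real.mul_rpow (by positivity) (Finset.sum_nonneg fun _ _ => abs_nonneg _),
      Real.div_rpow (by positivity) (by positivity)]
    refine (mul_le_mul_of_nonneg_left h2 (by positivity)).trans_eq ?_
    rw [← mul_assoc]
    congr 1
    rw [Real.rpow_sub_one (by positivity)]
    field_simp
  obtain h2p | hp2 := le_or_gt 2 p
  · refine ⟨1, one_pos, fun t a _ => ?_⟩
    rw [Real.rpow_one, mul_assoc]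
    refine mul_le_mul_of_nonneg_left (le_trans ?_ (hK t a)) (by positivity)
    have h := sum_rpow_le_rpow_sum t (a := fun j => a j ^ 2) (fun j => sq_nonneg _)
      (r := p / 2) (by linarith)
    rw [Real.sqrt_eq_rpow, ← Real.rpow_mul (Finset.sum_nonneg fun j _ => sq_nonneg _),
      show 1 / 2 * p = p / 2 by ring]
    refine le_trans (le_of_eq (Finset.sum_congr rfl fun j _ => ?_)) h
    rw [← sq_abs, ← Real.rpow_natCast, ← Real.rpow_mul (abs_nonneg _)]
    congr 1; push_cast; ring
  · refine ⟨1 - p / 2, by linarith, fun t a ht => ?_⟩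
    have hN : (0 : ℝ) < t.card := by exact_mod_cast ht.card_pos
    have h1 := sum_rpow_le_rpow_sum t (a := fun j => |a j|) (fun j => abs_nonneg _) hp
    have h2 : ∑ j ∈ t, |a j| ≤ √(t.card) * √(∑ j ∈ t, a j ^ 2) := by
      rw [← Real.sqrt_mul hN.le]
      refine Real.le_sqrt_of_sq_le (sq_sum_le_card_mul_sum_sq.trans_eq ?_)
      simp only [sq_abs]
    have h3 : ∑ j ∈ t, |a j| ^ p ≤ (t.card : ℝ) ^ (p / 2) * √(∑ j ∈ t, a j ^ 2) ^ p := by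
      refine h1.trans ((Real.rpow_le_rpow (Finset.sum_nonneg fun j _ => abs_nonneg _) h2
        hp0.le).trans_eq ?_)
      rw [Real.mul_rpow (Real.sqrt_nonneg _) (Real.sqrt_nonneg _), Real.sqrt_eq_rpow (t.card : ℝ),
        ← Real.rpow_mul hN.le]
      congr 2; ring
    calc _ ≤ (t.card : ℝ) ^ (1 - p / 2) * ((t.card : ℝ) ^ (p / 2) * √(∑ j ∈ t, a j ^ 2) ^ p) := by
          gcongr
      _ = t.card * √(∑ j ∈ t, a j ^ 2) ^ p := by
          rw [← mul_assoc, ← Real.rpow_add hN, sub_add_cancel, Real.rpow_one]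
      _ ≤ _ := by rw [mul_assoc]; gcongr; exact hK t a

end Khintchine

section UnconditionalConvergence

variable {X : Type*} [MeasurableSpace X] {m : Measure X} {p : ℝ}

lemma eLpNorm_ofReal_rpow (hp : 0 < p) (f : X → ℝ) :
    eLpNorm f (ENNReal.ofReal p) m ^ p = ∫⁻ x, ‖f x‖ₑ ^ p ∂m := by
  rw [eLpNorm_eq_lintegral_rpow_enorm_toReal (ENNReal.ofReal_pos.2 hp).ne' ENNReal.ofReal_ne_top,
    ENNReal.toReal_ofReal hp.le, ← ENNReal.rpow_mul, one_div_mul_cancel hp.ne', ENNReal.rpow_one]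

/-- If all the sums of `N` functions with signs are bounded by `K` in `L^p`, then one of the
functions is small, because of the power gain in `exists_rpow_mul_sum_le`. -/
lemma exists_card_bound (hp : 1 ≤ p) {K δ : ℝ≥0∞} (hK : K ≠ ∞) (hδ : δ ≠ 0) :
    ∃ N : ℕ, ∀ v : ℕ → X → ℝ, (∀ j, AEStronglyMeasurable (v j) m) →
      (∀ S ⊆ Finset.range N,
        eLpNorm (fun x => signSum (Finset.range N) (fun j => v j x) S) (ENNReal.ofReal p) m ≤ K) →
      ∃ j ∈ Finset.range N, eLpNorm (v j) (ENNReal.ofReal p) m < δ := by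
  have hp0 : 0 < p := by linarith
  obtain ⟨κ, hκ, hle⟩ := exists_rpow_mul_sum_le (ι := ℕ) hp
  have hδp : δ ^ p ≠ 0 := by simp [ENNReal.rpow_eq_zero_iff, hδ, hp0.not_gt]
  have hKp : ENNReal.ofReal (2 ^ p) * K ^ p / δ ^ p ≠ ∞ :=
    (ENNReal.div_lt_top (ENNReal.mul_ne_top ENNReal.ofReal_ne_top
      (ENNReal.rpow_ne_top_of_nonneg hp0.le hK)) hδp).ne
  obtain ⟨N, hN1, hN⟩ : ∃ N : ℕ, 0 < N ∧
      (ENNReal.ofReal (2 ^ p) * K ^ p / δ ^ p).toReal < (N : ℝ) ^ κ := by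
    have h := (tendsto_rpow_atTop hκ).comp (tendsto_natCast_atTop_atTop (R := ℝ))
    obtain ⟨N, h1, h2⟩ := ((eventually_gt_atTop 0).and
      (h.eventually_gt_atTop (ENNReal.ofReal (2 ^ p) * K ^ p / δ ^ p).toReal)).exists
    exact ⟨N, h1, h2⟩
  refine ⟨N, fun v hv hS => ?_⟩
  by_contra! hcon
  have hNpos : (0 : ℝ) < N := by exact_mod_cast hN1
  -- the pointwise inequality, integrated
  have hpt : ∀ x, ENNReal.ofReal ((N : ℝ) ^ κ) * ∑ j ∈ Finset.range N, ‖v j x‖ₑ ^ p ≤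
      ENNReal.ofReal (N * (2 ^ p / 2 ^ N)) * ∑ S ∈ (Finset.range N).powerset,
        ‖signSum (Finset.range N) (fun j => v j x) S‖ₑ ^ p := by
    intro x
    have h := ENNReal.ofReal_le_ofReal (hle (Finset.range N) (fun j => v j x)
      (Finset.nonempty_range_iff.2 hN1.ne'))
    rw [Finset.card_range, ENNReal.ofReal_mul (by positivity), ENNReal.ofReal_mul (by positivity),
      ENNReal.ofReal_sum_of_nonneg fun _ _ => by positivity,
      ENNReal.ofReal_sum_of_nonneg fun _ _ => by positivity] at h
    have he : ∀ y : ℝ, ENNReal.ofReal (|y| ^ p) = ‖y‖ₑ ^ p := fun y => by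
      rw [← ENNReal.ofReal_rpow_of_nonneg (abs_nonneg _) hp0.le, ← Real.norm_eq_abs, ofReal_norm]
    simpa only [he] using h
  have hsigm : ∀ S, AEStronglyMeasurable (fun x => signSum (Finset.range N) (fun j => v j x) S) m := by
    intro S
    refine Finset.aestronglyMeasurable_fun_sum _ fun j _ => ?_
    split_ifs
    exacts [hv j, (hv j).neg]
  have hint := lintegral_mono (μ := m) hpt
  rw [lintegral_const_mul' _ _ ENNReal.ofReal_ne_top, lintegral_const_mul' _ _ ENNReal.ofReal_ne_top,
    lintegral_finsetSum' _ fun j _ => (hv j).enorm.pow_const p,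
    lintegral_finsetSum' _ fun S _ => (hsigm S).enorm.pow_const p] at hint
  simp only [← eLpNorm_ofReal_rpow hp0] at hint
  have hlow : (N : ℝ≥0∞) * δ ^ p ≤
      ∑ j ∈ Finset.range N, eLpNorm (v j) (ENNReal.ofReal p) m ^ p := by
    calc (N : ℝ≥0∞) * δ ^ p = ∑ j ∈ Finset.range N, δ ^ p := by simp
      _ ≤ _ := Finset.sum_le_sum fun j hj => ENNReal.rpow_le_rpow (hcon j hj) hp0.le
  have hup : ∑ S ∈ (Finset.range N).powerset,
      eLpNorm (fun x => signSum (Finset.range N) (fun j => v j x) S) (ENNReal.ofReal p) m ^ p ≤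
      ENNReal.ofReal (2 ^ N) * K ^ p := by
    calc _ ≤ ∑ S ∈ (Finset.range N).powerset, K ^ p := Finset.sum_le_sum fun S hS' =>
          ENNReal.rpow_le_rpow (hS S (Finset.mem_powerset.1 hS')) hp0.le
      _ = _ := by
          rw [Finset.sum_const, Finset.card_powerset, Finset.card_range, nsmul_eq_mul]
          congr 1
          rw [ENNReal.ofReal_pow zero_le_two]; simp
  have h1 : ENNReal.ofReal ((N : ℝ) ^ κ) * (N * δ ^ p) ≤ N * (ENNReal.ofReal (2 ^ p) * K ^ p) := by
    calc _ ≤ _ := mul_le_mul_right hlow _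
      _ ≤ _ := hint
      _ ≤ _ := mul_le_mul_right hup _
      _ = _ := by
          rw [← mul_assoc, ← ENNReal.ofReal_mul (by positivity), ← mul_assoc]
          congr 1
          rw [mul_assoc, div_mul_cancel₀ _ (by positivity), ENNReal.ofReal_mul (by positivity),
            ENNReal.ofReal_natCast]
  rw [mul_left_comm, ENNReal.mul_le_mul_iff_right (by simpa using hN1.ne') (by simp)] at h1
  have h2 := ENNReal.le_div_iff_mul_le (.inl hδp) (.inr (ENNReal.mul_ne_top ENNReal.ofReal_ne_top
    (ENNReal.rpow_ne_top_of_nonneg hp0.le hK))) |>.2 h1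
  have h3 := ENNReal.toReal_mono hKp h2
  rw [ENNReal.toReal_ofReal (by positivity)] at h3
  linarith

/-- A series in `L^p` whose finite sums with arbitrary signs are bounded converges
unconditionally. -/
theorem exists_tendsto_of_signs_bounded {ι : Type*} (hp : 1 ≤ p) {u : ι → X → ℝ}
    (hu : ∀ i, MemLp (u i) (ENNReal.ofReal p) m) {K : ℝ≥0∞} (hK : K ≠ ∞)
    (hbound : ∀ (F : Finset ι) (s : ι → ℝ), (∀ i, |s i| ≤ 1) →
      eLpNorm (fun x => ∑ i ∈ F, s i * u i x) (ENNReal.ofReal p) m ≤ K) :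
    ∃ g : X → ℝ, MemLp g (ENNReal.ofReal p) m ∧
      Tendsto (fun F : Finset ι => eLpNorm (fun x => ∑ i ∈ F, u i x - g x) (ENNReal.ofReal p) m)
        atTop (𝓝 0) ∧ eLpNorm g (ENNReal.ofReal p) m ≤ K := by
  classical
  have : Fact (1 ≤ ENNReal.ofReal p) := ⟨by simpa using ENNReal.ofReal_le_ofReal hp⟩
  -- the sums over finite sets far out are small
  have hvanish : ∀ δ : ℝ≥0∞, δ ≠ 0 → ∃ F₀ : Finset ι, ∀ F, Disjoint F F₀ →
      eLpNorm (fun x => ∑ i ∈ F, u i x) (ENNReal.ofReal p) m < δ := by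
    intro δ hδ
    by_contra! hcon
    choose next hdisj hnext using hcon
    obtain ⟨N, hN⟩ := exists_card_bound (m := m) hp hK hδ
    -- successive disjoint blocks with large sums
    let acc : ℕ → Finset ι := fun j => Nat.rec ∅ (fun _ S => S ∪ next S) j
    have hacc : ∀ j, acc (j + 1) = acc j ∪ next (acc j) := fun j => rfl
    have hmono : Monotone acc := monotone_nat_of_le_succ fun j => by
      rw [hacc]; exact Finset.subset_union_left
    have hBd : ∀ j k, j < k → Disjoint (next (acc k)) (next (acc j)) := fun j k hjk =>
      (hdisj (acc k)).mono_right (Finset.subset_union_right.trans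
        (by rw [← hacc]; exact hmono hjk))
    have hpair : (Finset.range N : Set ℕ).PairwiseDisjoint fun j => next (acc j) := by
      intro j _ k _ hjk
      rcases lt_or_gt_of_ne hjk with h | h
      exacts [(hBd j k h).symm, hBd k j h]
    obtain ⟨j, _, hj⟩ := hN (fun j x => ∑ i ∈ next (acc j), u i x)
      (fun j => Finset.aestronglyMeasurable_fun_sum _ fun i _ => (hu i).aestronglyMeasurable) (by
        intro S hS
        let T := S.biUnion fun j => next (acc j)
        refine le_trans (le_of_eq ?_) (hbound ((Finset.range N).biUnion fun j => next (acc j))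
          (fun i => if i ∈ T then 1 else -1) fun i => by split_ifs <;> simp)
        congr 1
        funext x
        rw [Finset.sum_biUnion hpair, signSum]
        refine Finset.sum_congr rfl fun j hj => ?_
        split_ifs with hjS
        · refine Finset.sum_congr rfl fun i hi => ?_
          rw [if_pos (Finset.mem_biUnion.2 ⟨j, hjS, hi⟩), one_mul]
        · rw [← Finset.sum_neg_distrib]
          refine Finset.sum_congr rfl fun i hi => ?_
          rw [if_neg, neg_one_mul]
          intro hiT
          obtain ⟨k, hk, hik⟩ := Finset.mem_biUnion.1 hiT
          have hkj : j ≠ k := fun h => hjS (h ▸ hk)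
          exact Finset.disjoint_left.1 (hpair (Finset.mem_coe.2 hj) (Finset.mem_coe.2 (hS hk)) hkj)
            hi hik)
    exact absurd hj (not_lt.2 (hnext (acc j)))
  let U : ι → Lp ℝ (ENNReal.ofReal p) m := fun i => (hu i).toLp (u i)
  have hsumLp : ∀ F : Finset ι, MemLp (fun x => ∑ i ∈ F, u i x) (ENNReal.ofReal p) m := fun F =>
    memLp_finsetSum _ fun i _ => hu i
  have hU : ∀ F : Finset ι, ∑ i ∈ F, U i = (hsumLp F).toLp := by
    intro F
    induction F using Finset.induction_on with
    | empty =>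
      rw [Finset.sum_empty, ← MemLp.toLp_zero (MemLp.zero (ε := ℝ))]
      exact MemLp.toLp_congr _ _ (.of_forall fun x => by simp)
    | insert i F hi ih =>
      rw [Finset.sum_insert hi, ih, ← MemLp.toLp_add]
      exact MemLp.toLp_congr _ _ (.of_forall fun x => by simp [Finset.sum_insert hi])
  have hsummable : Summable U := by
    refine summable_iff_vanishing_norm.2 fun ε hε => ?_
    obtain ⟨F₀, h⟩ := hvanish (ENNReal.ofReal ε) (ENNReal.ofReal_pos.2 hε).ne'
    refine ⟨F₀, fun F hF => ?_⟩
    rw [hU, Lp.norm_toLp]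
    exact ENNReal.toReal_lt_of_lt_ofReal (h F hF)
  set G := ∑' i, U i with hG
  have htend : Tendsto (fun F : Finset ι => eLpNorm (fun x => ∑ i ∈ F, u i x - G x)
      (ENNReal.ofReal p) m) atTop (𝓝 0) := by
    have h := (Lp.tendsto_Lp_iff_tendsto_eLpNorm' _ _).1 hsummable.hasSum
    refine h.congr fun F => eLpNorm_congr_ae ?_
    rw [hU]
    filter_upwards [(hsumLp F).coeFn_toLp] with x hx
    simp only [Pi.sub_apply, hx]
    rfl
  refine ⟨G, Lp.memLp G, htend, ?_⟩
  have hle : ∀ F : Finset ι, eLpNorm G (ENNReal.ofReal p) m ≤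
      K + eLpNorm (fun x => ∑ i ∈ F, u i x - G x) (ENNReal.ofReal p) m := by
    intro F
    have h1 : (G : X → ℝ) = (fun x => ∑ i ∈ F, u i x) - fun x => ∑ i ∈ F, u i x - G x := by
      funext x; simp
    nth_rw 1 [h1]
    refine (eLpNorm_sub_le (hsumLp F).aestronglyMeasurable
      ((hsumLp F).sub (Lp.memLp G)).aestronglyMeasurable Fact.out).trans (add_le_add_left ?_ _)
    simpa using hbound F (fun _ => 1) (by simp)
  simpa using ge_of_tendsto' (htend.const_add K) hle

end UnconditionalConvergence

end UnconditionalSeries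

/-! ### Boundedness of the paraproducts -/

section Boundedness

variable {n : ℕ}

/-- The properties of the terms `t Q f` of a paraproduct with symbol `b` that are used: they only
depend on the values of `f` on `Q`, are bounded measurable functions supported in `Q`, and their
pairing with a function `g` is bounded by terms of the forms in which `b` and one of `f`, `g` are in
the cancellative positions. In `congr`, a null set of `Q` may be disregarded. -/
structure IsParaproductTerm (b : (Fin n → ℝ) → ℝ)
    (t : Cube n → ((Fin n → ℝ) → ℝ) → (Fin n → ℝ) → ℝ) : Prop where
  congr : ∀ Q f f', (∀ᵐ x, x ∈ Q.toSet → f x = f' x) → t Q f = t Q f'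
  measurable : ∀ Q f, Measurable (t Q f)
  bounded : ∀ Q f, ∃ c, 0 ≤ c ∧ ∀ x, |t Q f x| ≤ Q.toSet.indicator (fun _ => c) x
  pairing : ∀ Q f g, LocallyIntegrable f → LocallyIntegrable g →
    |∫ x, t Q f x * g x| ≤ ∑ ε ∈ cancellative n, ∑ θ ∈ cancellative n,
      (formTerm b f g ε θ Q + formTerm b g f ε θ Q)

section Bound

variable {D : DyadicGrid n} {p : ℝ} {mu lam b : (Fin n → ℝ) → ℝ}

lemma IsParaproductTerm.memLp {t : Cube n → ((Fin n → ℝ) → ℝ) → (Fin n → ℝ) → ℝ}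
    (ht : IsParaproductTerm b t) (hlam : IsWeight lam) (Q : Cube n) (f : (Fin n → ℝ) → ℝ)
    (r : ℝ≥0∞) : MemLp (t Q f) r (weightMeasure lam) := by
  obtain ⟨c, _, hc⟩ := ht.bounded Q f
  exact (memLp_indicator_const r Q.measurableSet c (.inr (weightMeasure_ne_top hlam Q))).mono'
    (ht.measurable Q f).aestronglyMeasurable (.of_forall hc)

lemma lintegral_weightMeasure {w : (Fin n → ℝ) → ℝ} (hw : AEMeasurable w)
    (h : (Fin n → ℝ) → ℝ≥0∞) :
    ∫⁻ x, h x ∂weightMeasure w = ∫⁻ x, ENNReal.ofReal (w x) * h x :=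
  lintegral_withDensity_eq_lintegral_mul_non_measurable₀ _ hw.ennreal_ofReal
    (.of_forall fun _ => ENNReal.ofReal_lt_top) _

lemma aemeasurable_of_weightMeasure {w f : (Fin n → ℝ) → ℝ} (hw : IsWeight w)
    (hf : AEStronglyMeasurable f (weightMeasure w)) : AEMeasurable f :=
  (hf.mono_ac (withDensity_absolutelyContinuous' hw.aemeasurable.ennreal_ofReal
    (by filter_upwards [hw.2] with x hx using (ENNReal.ofReal_pos.2 hx).ne'))).aemeasurable

/-- A function of `L^p(μ)` is integrable on the sets of finite measure with respect to `μ'`. -/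
lemma lintegral_enorm_indicator_ne_top (hp : 1 < p) (hmu : IsWeight mu) {f : (Fin n → ℝ) → ℝ}
    (hf : MemLp f (ENNReal.ofReal p) (weightMeasure mu)) {U : Set (Fin n → ℝ)}
    (hUm : MeasurableSet U) (hU : weightMeasure (conjWeight p mu) U ≠ ∞) :
    ∫⁻ x, ‖U.indicator f x‖ₑ ≠ ∞ := by
  have hpq := Real.HolderConjugate.conjExponent hp
  have hp0 := hpq.pos
  have hq0 := hpq.symm.pos
  have hfm := aemeasurable_of_weightMeasure hmu hf.1
  have h1 : ∫⁻ x, ‖U.indicator f x‖ₑ = ∫⁻ x in U, ‖f x‖ₑ := by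
    rw [← lintegral_indicator hUm]
    exact lintegral_congr fun x => enorm_indicator_eq_indicator_enorm _ _
  have hH := ENNReal.lintegral_mul_le_Lp_mul_Lq (volume.restrict U) hpq
    (f := fun x => ‖f x‖ₑ * ENNReal.ofReal (mu x) ^ (1 / p))
    (g := fun x => ENNReal.ofReal (conjWeight p mu x) ^ (1 / p.conjExponent))
    (hfm.restrict.enorm.mul (hmu.aemeasurable.restrict.ennreal_ofReal.pow_const _))
    ((aemeasurable_conjWeight hmu p).restrict.ennreal_ofReal.pow_const _)
  have h2 : ∫⁻ x in U, ‖f x‖ₑ = ∫⁻ x in U, ((fun x => ‖f x‖ₑ * ENNReal.ofReal (mu x) ^ (1 / p)) *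
      fun x => ENNReal.ofReal (conjWeight p mu x) ^ (1 / p.conjExponent)) x := by
    refine lintegral_congr_ae ?_
    filter_upwards [ae_restrict_of_ae hmu.2, ae_restrict_of_ae (ae_conjWeight_pos hmu p)]
      with x hx hy
    rw [Pi.mul_apply, mul_assoc, ENNReal.ofReal_rpow_of_pos hx, ENNReal.ofReal_rpow_of_pos hy,
      conjWeight_rpow hp hx, ← ENNReal.ofReal_mul (by positivity), ← Real.rpow_add hx,
      add_neg_cancel, Real.rpow_zero, ENNReal.ofReal_one, mul_one]
  rw [h1, h2]
  refine ne_top_of_le_ne_top (ENNReal.mul_ne_top (ENNReal.rpow_ne_top_of_nonneg (by positivity) ?_)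
    (ENNReal.rpow_ne_top_of_nonneg (by positivity) ?_)) hH
  · have hfin : eLpNorm f (ENNReal.ofReal p) (weightMeasure mu) ^ p ≠ ∞ :=
      ENNReal.rpow_ne_top_of_nonneg hp0.le hf.2.ne
    rw [eLpNorm_ofReal_rpow hp0, lintegral_weightMeasure hmu.aemeasurable] at hfin
    refine ne_top_of_le_ne_top hfin ((setLIntegral_le_lintegral U _).trans_eq
      (lintegral_congr fun x => ?_))
    rw [ENNReal.mul_rpow_of_nonneg _ _ hp0.le, ← ENNReal.rpow_mul, one_div_mul_cancel hp0.ne',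
      ENNReal.rpow_one, mul_comm]
  · simp only [← ENNReal.rpow_mul, one_div_mul_cancel hq0.ne', ENNReal.rpow_one]
    rwa [← weightMeasure_apply]

/-- The map `f ↦ f / μ'` preserves norms from `L^p(μ)` to `L^p(μ')`, since `μ' = μ (μ')^p`; the
cut-off of `f` to `U` does not increase the norm. -/
lemma lintegral_enorm_div_conjWeight_le (hp : 1 < p) (hmu : IsWeight mu) (f : (Fin n → ℝ) → ℝ)
    (U : Set (Fin n → ℝ)) :
    ∫⁻ x, ‖U.indicator f x / conjWeight p mu x‖ₑ ^ p ∂weightMeasure (conjWeight p mu) ≤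
      eLpNorm f (ENNReal.ofReal p) (weightMeasure mu) ^ p := by
  have hpq := Real.HolderConjugate.conjExponent hp
  have hp0 := hpq.pos
  rw [eLpNorm_ofReal_rpow hp0, lintegral_weightMeasure hmu.aemeasurable,
    lintegral_weightMeasure (aemeasurable_conjWeight hmu p)]
  refine lintegral_mono_ae ?_
  filter_upwards [hmu.2, ae_conjWeight_pos hmu p] with x hx hy
  have h1 : conjWeight p mu x = mu x * conjWeight p mu x ^ p := by
    have : (1 : ℝ) + (1 - p.conjExponent) * p = 1 - p.conjExponent := by
      have := hpq.mul_eq_add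
      linarith
    rw [conjWeight, ← Real.rpow_mul hx.le]
    nth_rw 2 [← Real.rpow_one (mu x)]
    rw [← Real.rpow_add hx, this]
  rw [div_eq_mul_inv, enorm_mul, ENNReal.mul_rpow_of_nonneg _ _ hp0.le,
    Real.enorm_of_nonneg (inv_nonneg.2 hy.le), ENNReal.ofReal_rpow_of_pos (inv_pos.2 hy),
    mul_left_comm, ← ENNReal.ofReal_mul hy.le, mul_comm]
  have h2 : conjWeight p mu x * (conjWeight p mu x)⁻¹ ^ p = mu x := by
    nth_rw 1 [h1]
    rw [Real.inv_rpow hy.le, mul_assoc, mul_inv_cancel₀ (Real.rpow_pos_of_pos hy _).ne', mul_one]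
  rw [h2]
  gcongr
  rw [enorm_indicator_eq_indicator_enorm]
  exact Set.indicator_le_self _ _ _

/-- The constant in the norm bound of the paraproducts. -/
def paraproductConst (n : ℕ) (p : ℝ) : ℝ :=
  (cancellative n).card * ((cancellative n).card * (2 * formConst n p))

/-- The finite sums of a paraproduct, with signs, are bounded from `L^p(μ)` to `L^p(λ)`. This is
proved by duality: the sum `T` is paired with `T |T|^{p-2} λ`. -/
theorem eLpNorm_sum_le (hn : 0 < n) (hp : 1 < p) (hmu : IsApWeight D p mu)
    (hlam : IsApWeight D p lam) (hb : MemBMO D (bloomWeight p mu lam) b)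
    {t : Cube n → ((Fin n → ℝ) → ℝ) → (Fin n → ℝ) → ℝ} (ht : IsParaproductTerm b t)
    {f : (Fin n → ℝ) → ℝ} (hf : MemLp f (ENNReal.ofReal p) (weightMeasure mu))
    (F : Finset D.cubes) (s : D.cubes → ℝ) (hs : ∀ i, |s i| ≤ 1) :
    eLpNorm (fun x => ∑ i ∈ F, s i * t i f x) (ENNReal.ofReal p) (weightMeasure lam) ≤
      ENNReal.ofReal (paraproductConst n p * bloomConst D p mu lam b) *
        eLpNorm f (ENNReal.ofReal p) (weightMeasure mu) := by
  have hpq := Real.HolderConjugate.conjExponent hp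
  have hp0 := hpq.pos
  have hq0 := hpq.symm.pos
  set q := p.conjExponent with hq
  set T : (Fin n → ℝ) → ℝ := fun x => ∑ i ∈ F, s i * t i f x with hT
  have hTm : Measurable T := Finset.measurable_sum _ fun i _ => (ht.measurable i f).const_mul _
  have hTLp : MemLp T (ENNReal.ofReal p) (weightMeasure lam) :=
    memLp_finsetSum _ fun i _ => (ht.memLp hlam.1 i f _).const_mul _
  obtain ⟨M, hM⟩ : ∃ M, ∀ x, |T x| ≤ M := by
    choose c hc0 hc using fun Q => ht.bounded Q f
    refine ⟨∑ i ∈ F, c i, fun x => (Finset.abs_sum_le_sum_abs _ _).trans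
      (Finset.sum_le_sum fun i _ => ?_)⟩
    rw [abs_mul]
    refine (mul_le_of_le_one_left (abs_nonneg _) (hs i)).trans ((hc i x).trans ?_)
    exact Set.indicator_le_self' (fun _ _ => hc0 i) x
  -- the function `f`, cut off to the cubes that occur
  set U : Set (Fin n → ℝ) := ⋃ i ∈ F, i.1.toSet with hU
  have hUm : MeasurableSet U := Finset.measurableSet_biUnion _ fun i _ => i.1.measurableSet
  set σ := conjWeight p mu with hσ
  have hσm : AEMeasurable σ := aemeasurable_conjWeight hmu.1 p
  have hσ0 : ∀ᵐ x, 0 < σ x := ae_conjWeight_pos hmu.1 p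
  have hσU : weightMeasure σ U ≠ ∞ := (measure_biUnion_lt_top F.finite_toSet fun i _ =>
    (hmu.weightMeasure_conjWeight_ne_top hp i.2).lt_top).ne
  have hfm : AEMeasurable f := aemeasurable_of_weightMeasure hmu.1 hf.1
  set f₀ : (Fin n → ℝ) → ℝ := fun x => U.indicator f x / σ x with hf₀
  have hf₀m : AEMeasurable f₀ := (hfm.indicator hUm).div hσm
  have hff : (fun x => f₀ x * σ x) =ᵐ[volume] U.indicator f := by
    filter_upwards [hσ0] with x hx
    exact div_mul_cancel₀ _ hx.ne'
  have hfloc : LocallyIntegrable fun x => f₀ x * σ x := by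
    refine Integrable.locallyIntegrable ((integrable_congr hff).2 ⟨?_, ?_⟩)
    · exact (hfm.indicator hUm).aestronglyMeasurable
    · exact (lintegral_enorm_indicator_ne_top hp hmu.1 hf hUm hσU).lt_top
  have hf₀le := lintegral_enorm_div_conjWeight_le hp hmu.1 f U
  rw [← hσ] at hf₀le
  have hfp_fin : eLpNorm f (ENNReal.ofReal p) (weightMeasure mu) ^ p ≠ ∞ :=
    ENNReal.rpow_ne_top_of_nonneg hp0.le hf.2.ne
  -- the dual function
  set g₀ : (Fin n → ℝ) → ℝ := fun x => T x * |T x| ^ (p - 2) with hg₀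
  have hg₀m : Measurable g₀ := hTm.mul ((_root_.measurable_abs.comp hTm).pow_const _)
  have hg₀abs : ∀ x, |g₀ x| = |T x| ^ (p - 1) := fun x => by
    rw [hg₀, abs_mul, abs_of_nonneg (Real.rpow_nonneg (abs_nonneg _) _)]
    obtain h0 | h0 := (abs_nonneg (T x)).eq_or_lt
    · rw [← h0, zero_mul, Real.zero_rpow (by linarith)]
    · nth_rw 1 [← Real.rpow_one |T x|]
      rw [← Real.rpow_add h0]; congr 1; ring
  have hTg : ∀ x, T x * g₀ x = |T x| ^ p := fun x => by
    have h1 : T x * g₀ x = |T x| * |g₀ x| := by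
      rw [hg₀, abs_mul, abs_of_nonneg (Real.rpow_nonneg (abs_nonneg (T x)) (p - 2)), ← mul_assoc,
        ← mul_assoc, abs_mul_abs_self]
    rw [h1, hg₀abs]
    obtain h0 | h0 := (abs_nonneg (T x)).eq_or_lt
    · rw [← h0, zero_mul, Real.zero_rpow hp0.ne']
    · nth_rw 1 [← Real.rpow_one |T x|]
      rw [← Real.rpow_add h0]; congr 1; ring
  have hgloc : LocallyIntegrable fun x => g₀ x * lam x := by
    refine (hlam.1.1.smul (M ^ (p - 1))).mono (hg₀m.aestronglyMeasurable.mul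
      hlam.1.1.aestronglyMeasurable) (.of_forall fun x => ?_)
    have hM0 : 0 ≤ M := (abs_nonneg _).trans (hM x)
    change |g₀ x * lam x| ≤ |M ^ (p - 1) * lam x|
    rw [abs_mul (g₀ x), abs_mul (M ^ (p - 1)), hg₀abs, abs_of_nonneg (Real.rpow_nonneg hM0 _)]
    exact mul_le_mul_of_nonneg_right (Real.rpow_le_rpow (abs_nonneg _) (hM x) (by linarith))
      (abs_nonneg _)
  set J := ∫⁻ x, ‖T x‖ₑ ^ p ∂weightMeasure lam with hJ
  have hJT : eLpNorm T (ENNReal.ofReal p) (weightMeasure lam) ^ p = J := eLpNorm_ofReal_rpow hp0 T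
  have hJfin : J ≠ ∞ := by
    rw [← hJT]; exact ENNReal.rpow_ne_top_of_nonneg hp0.le hTLp.2.ne
  have hJg : ∫⁻ x, ‖g₀ x‖ₑ ^ q ∂weightMeasure lam = J := by
    refine lintegral_congr fun x => ?_
    have e : ‖g₀ x‖ₑ = ‖T x‖ₑ ^ (p - 1) := by
      rw [← ofReal_norm, Real.norm_eq_abs, hg₀abs,
        ← ENNReal.ofReal_rpow_of_nonneg (abs_nonneg _) (by linarith), ← Real.norm_eq_abs,
        ofReal_norm]
    rw [e, ← ENNReal.rpow_mul, hpq.sub_one_mul_conj]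
  have hJint : J.toReal = ∫ x, T x * (g₀ x * lam x) := by
    simp only [← mul_assoc, hTg]
    rw [integral_eq_lintegral_of_nonneg_ae, hJ, lintegral_weightMeasure hlam.1.aemeasurable]
    · congr 1
      refine lintegral_congr_ae ?_
      filter_upwards [hlam.1.2] with x hx
      rw [mul_comm, ENNReal.ofReal_mul (by positivity),
        ← ENNReal.ofReal_rpow_of_nonneg (abs_nonneg _) hp0.le, ← Real.norm_eq_abs, ofReal_norm]
    · filter_upwards [hlam.1.2] with x hx
      exact mul_nonneg (Real.rpow_nonneg (abs_nonneg _) _) hx.le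
    · exact ((_root_.measurable_abs.comp hTm).pow_const _).aestronglyMeasurable.mul
        hlam.1.1.aestronglyMeasurable
  set B := formConst n p * bloomConst D p mu lam b *
    ((∫⁻ x, ‖f₀ x‖ₑ ^ p ∂weightMeasure σ).toReal ^ (1 / p) * J.toReal ^ (1 / q)) with hB
  have hform : ∀ ε ∈ cancellative n, ∀ θ ∈ cancellative n,
      ∑ i ∈ F, (formTerm b (fun x => f₀ x * σ x) (fun x => g₀ x * lam x) ε θ i.1 +
        formTerm b (fun x => g₀ x * lam x) (fun x => f₀ x * σ x) ε θ i.1) ≤ 2 * B := by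
    intro ε hε θ hθ
    have h := sum_formTerm_weighted_le hn hp hmu hlam hb
      (F := F.map (Function.Embedding.subtype _)) (by
        intro Q hQ
        obtain ⟨i, _, rfl⟩ := Finset.mem_map.1 hQ
        exact i.2)
      (hf₀m.mono_ac (withDensity_absolutelyContinuous _ _)) hg₀m.aemeasurable hfloc hgloc
      (ne_top_of_le_ne_top hfp_fin hf₀le) (by rw [← hq, hJg]; exact hJfin) hε hθ
    simp only [Finset.sum_map, Function.Embedding.subtype_apply, ← hq, ← hσ, hJg] at h
    rw [Finset.sum_add_distrib]
    linarith [h.1, h.2]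
  have hpair : J.toReal ≤ (cancellative n).card * ((cancellative n).card * (2 * B)) := by
    have hterm : ∀ i ∈ F, ∫ x, s i * t i f x * (g₀ x * lam x) ≤
        ∑ ε ∈ cancellative n, ∑ θ ∈ cancellative n,
          (formTerm b (fun x => f₀ x * σ x) (fun x => g₀ x * lam x) ε θ i.1 +
            formTerm b (fun x => g₀ x * lam x) (fun x => f₀ x * σ x) ε θ i.1) := by
      intro i hi
      rw [ht.congr i.1 f (fun x => f₀ x * σ x) (by
        filter_upwards [hff] with x hx hxi
        have hxU : x ∈ U := Set.mem_iUnion₂.2 ⟨i, hi, hxi⟩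
        rw [hx, Set.indicator_of_mem hxU])]
      refine le_trans ?_ (ht.pairing i.1 _ _ hfloc hgloc)
      simp only [mul_assoc (s i), integral_const_mul]
      exact (le_abs_self _).trans
        ((abs_mul _ _).trans_le (mul_le_of_le_one_left (abs_nonneg _) (hs i)))
    have hint : ∀ i ∈ F, Integrable fun x => s i * t i f x * (g₀ x * lam x) := by
      intro i _
      obtain ⟨c, hc0, hc⟩ := ht.bounded i.1 f
      have h1 : Integrable (i.1.toSet.indicator fun x => g₀ x * lam x) :=
        (integrable_indicator_iff i.1.measurableSet).2 (i.1.integrableOn hgloc)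
      refine (h1.bdd_mul (c := c) ((ht.measurable i.1 f).const_mul (s i)).aestronglyMeasurable
        (.of_forall fun x => ?_)).congr (.of_forall fun x => ?_)
      · rw [norm_mul]
        refine (mul_le_of_le_one_left (norm_nonneg _) (hs i)).trans ((hc x).trans ?_)
        exact Set.indicator_le_self' (fun _ _ => hc0) x
      · by_cases hx : x ∈ i.1.toSet
        · simp [hx]
        · have : t i.1 f x = 0 := by simpa [hx] using hc x
          simp [hx, this]
    rw [hJint]
    simp only [hT, Finset.sum_mul]
    rw [integral_finsetSum _ hint]
    refine (Finset.sum_le_sum hterm).trans ?_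
    rw [Finset.sum_comm, ← nsmul_eq_mul]
    refine Finset.sum_le_card_nsmul _ _ _ fun ε hε => ?_
    rw [Finset.sum_comm, ← nsmul_eq_mul]
    exact Finset.sum_le_card_nsmul _ _ _ fun θ hθ => hform ε hε θ hθ
  have hA0 : 0 ≤ paraproductConst n p * bloomConst D p mu lam b := by
    have : 0 ≤ p - 1 := by linarith
    unfold paraproductConst formConst bloomConst
    rw [← hq]
    positivity
  -- cancellation of the power of `J`
  have hreal : J.toReal ^ (1 / p) ≤ paraproductConst n p * bloomConst D p mu lam b *
      (∫⁻ x, ‖f₀ x‖ₑ ^ p ∂weightMeasure σ).toReal ^ (1 / p) := by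
    obtain h0 | h0 := (ENNReal.toReal_nonneg (a := J)).eq_or_lt
    · rw [← h0, Real.zero_rpow (by positivity)]; positivity
    have hsplit : J.toReal = J.toReal ^ (1 / p) * J.toReal ^ (1 / q) := by
      rw [← Real.rpow_add h0, one_div, one_div, hpq.inv_add_inv_eq_one, Real.rpow_one]
    refine le_of_mul_le_mul_right ?_ (Real.rpow_pos_of_pos h0 (1 / q))
    rw [← hsplit]
    refine hpair.trans_eq ?_
    rw [hB, paraproductConst]; ring
  have e1 : eLpNorm T (ENNReal.ofReal p) (weightMeasure lam) = ENNReal.ofReal (J.toReal ^ (1 / p)) := by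
    rw [ENNReal.toReal_rpow, ENNReal.ofReal_toReal (ENNReal.rpow_ne_top_of_nonneg (by positivity) hJfin),
      ← hJT, ← ENNReal.rpow_mul, mul_one_div_cancel hp0.ne', ENNReal.rpow_one]
  have e2 : (∫⁻ x, ‖f₀ x‖ₑ ^ p ∂weightMeasure σ).toReal ^ (1 / p) ≤
      (eLpNorm f (ENNReal.ofReal p) (weightMeasure mu)).toReal := by
    have := Real.rpow_le_rpow ENNReal.toReal_nonneg (ENNReal.toReal_mono hfp_fin hf₀le)
      (by positivity : 0 ≤ 1 / p)
    rwa [← ENNReal.toReal_rpow, ← Real.rpow_mul ENNReal.toReal_nonneg, mul_one_div_cancel hp0.ne',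
      Real.rpow_one] at this
  rw [e1, ← ENNReal.ofReal_toReal hf.2.ne, ← ENNReal.ofReal_mul hA0]
  exact ENNReal.ofReal_le_ofReal (hreal.trans (mul_le_mul_of_nonneg_left e2 hA0))

theorem seriesNormLE_of_isParaproductTerm (hn : 0 < n) (hp : 1 < p) (hmu : IsApWeight D p mu)
    (hlam : IsApWeight D p lam) (hb : MemBMO D (bloomWeight p mu lam) b)
    {t : Cube n → ((Fin n → ℝ) → ℝ) → (Fin n → ℝ) → ℝ} (ht : IsParaproductTerm b t) :
    SeriesNormLE D p mu lam t ((paraproductConst n p).toNNReal *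
      bmoNorm D (bloomWeight p mu lam) b * apChar D p mu ^ (1 / (p - 1)) * apChar D p lam) := by
  intro f hf
  have hp1 : 0 ≤ 1 / (p - 1) := one_div_nonneg.2 (by linarith)
  have hA0 : 0 ≤ paraproductConst n p := by
    have := (Real.HolderConjugate.conjExponent hp).symm.pos
    unfold paraproductConst formConst
    positivity
  have hconst : ENNReal.ofReal (paraproductConst n p * bloomConst D p mu lam b) =
      (paraproductConst n p).toNNReal * bmoNorm D (bloomWeight p mu lam) b *
        apChar D p mu ^ (1 / (p - 1)) * apChar D p lam := by
    rw [bloomConst, ENNReal.ofReal_mul hA0, ENNReal.ofReal_mul (by positivity),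
      ENNReal.ofReal_mul (by positivity), ENNReal.ofReal_toReal hb.2.ne,
      ENNReal.ofReal_toReal hlam.2.ne, ENNReal.toReal_rpow,
      ENNReal.ofReal_toReal (ENNReal.rpow_ne_top_of_nonneg hp1 hmu.2.ne), ← mul_assoc, ← mul_assoc]
    rfl
  rw [← hconst]
  obtain ⟨g, h1, h2, h3⟩ := exists_tendsto_of_signs_bounded hp.le
    (fun i : D.cubes => ht.memLp hlam.1 i.1 f (ENNReal.ofReal p))
    (ENNReal.mul_ne_top ENNReal.ofReal_ne_top hf.2.ne)
    (eLpNorm_sum_le hn hp hmu hlam hb ht hf)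
  exact ⟨g, ⟨h1, h2⟩, h3⟩

end Bound

end Boundedness

/-! ### The three paraproducts -/

section Paraproducts

variable {n : ℕ}

lemma haarCoeff_congr {f f' : (Fin n → ℝ) → ℝ} {Q : Cube n}
    (h : ∀ᵐ x, x ∈ Q.toSet → f x = f' x) (ε : Fin n → Bool) :
    haarCoeff f Q ε = haarCoeff f' Q ε := by
  refine integral_congr_ae ?_
  filter_upwards [h] with x hx
  by_cases hxQ : x ∈ Q.toSet
  · rw [hx hxQ]
  · rw [haar_of_notMem hxQ, mul_zero, mul_zero]

lemma avg_congr {f f' : (Fin n → ℝ) → ℝ} {Q : Cube n} (h : ∀ᵐ x, x ∈ Q.toSet → f x = f' x) :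
    avg f Q = avg f' Q := by
  rw [avg_eq, avg_eq, setIntegral_congr_ae Q.measurableSet h]

lemma exists_indicator_bound_sum {ι : Type*} (s : Finset ι) {Q : Cube n}
    {F : ι → (Fin n → ℝ) → ℝ}
    (h : ∀ i ∈ s, ∃ c, 0 ≤ c ∧ ∀ x, |F i x| ≤ Q.toSet.indicator (fun _ => c) x) :
    ∃ c, 0 ≤ c ∧ ∀ x, |∑ i ∈ s, F i x| ≤ Q.toSet.indicator (fun _ => c) x := by
  classical
  induction s using Finset.induction_on with
  | empty => exact ⟨0, le_rfl, fun x => by simp⟩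
  | insert i s hi ih =>
    obtain ⟨c, hc0, hc⟩ := ih fun j hj => h j (Finset.mem_insert_of_mem hj)
    obtain ⟨d, hd0, hd⟩ := h i (Finset.mem_insert_self _ _)
    refine ⟨d + c, by positivity, fun x => ?_⟩
    rw [Finset.sum_insert hi, Set.indicator_add (f := fun _ => d) (g := fun _ => c)]
    exact (abs_add_le _ _).trans (add_le_add (hd x) (hc x))

lemma exists_indicator_bound_haar (a : ℝ) (Q : Cube n) (ε : Fin n → Bool) :
    ∃ c, 0 ≤ c ∧ ∀ x, |a * haar Q ε x| ≤ Q.toSet.indicator (fun _ => c) x := by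
  refine ⟨|a| * (√Q.vol)⁻¹, by positivity, fun x => ?_⟩
  rw [abs_mul, Set.indicator_const_mul]
  exact mul_le_mul_of_nonneg_left (abs_haar_le Q ε x) (abs_nonneg a)

lemma integral_mul_haar_mul (a : ℝ) (Q : Cube n) (ε : Fin n → Bool) (g : (Fin n → ℝ) → ℝ) :
    ∫ x, a * haar Q ε x * g x = a * haarCoeff g Q ε := by
  rw [haarCoeff, ← integral_const_mul]
  exact integral_congr_ae (.of_forall fun x => by ring)

lemma integrable_mul_haar_mul (a : ℝ) {g : (Fin n → ℝ) → ℝ} (hg : LocallyIntegrable g) (Q : Cube n)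
    (ε : Fin n → Bool) : Integrable fun x => a * haar Q ε x * g x :=
  ((integrable_mul_haar hg Q ε).const_mul a).congr (.of_forall fun x => by ring)

section Pairing

variable {b : (Fin n → ℝ) → ℝ}

/-- The form terms with equal signatures are part of the sum over all pairs of signatures. -/
lemma sum_diag_le_sum_sum {a : (Fin n → Bool) → (Fin n → Bool) → ℝ} (ha : ∀ ε θ, 0 ≤ a ε θ) :
    ∑ ε ∈ cancellative n, a ε ε ≤ ∑ ε ∈ cancellative n, ∑ θ ∈ cancellative n, a ε θ :=
  Finset.sum_le_sum fun ε hε =>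
    Finset.single_le_sum (f := fun θ => a ε θ) (fun θ _ => ha ε θ) hε

lemma isParaproductTerm_piTerm (b : (Fin n → ℝ) → ℝ) : IsParaproductTerm b (piTerm b) where
  congr Q f f' h := by
    funext x
    simp only [piTerm, avg_congr h]
  measurable Q f := Finset.measurable_sum _ fun ε _ => (measurable_haar Q ε).const_mul _
  bounded Q f := exists_indicator_bound_sum _ fun ε _ => exists_indicator_bound_haar _ Q ε
  pairing Q f g hf hg := by
    simp only [piTerm, Finset.sum_mul]
    rw [integral_finsetSum _ fun ε _ => integrable_mul_haar_mul _ hg Q ε]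
    simp only [integral_mul_haar_mul]
    refine (Finset.abs_sum_le_sum_abs _ _).trans (le_trans (Finset.sum_le_sum fun ε _ => ?_)
      (sum_diag_le_sum_sum (a := fun ε θ => formTerm b f g ε θ Q + formTerm b g f ε θ Q)
        fun ε θ => add_nonneg (formTerm_nonneg _ _ _ _ _ _) (formTerm_nonneg _ _ _ _ _ _)))
    refine le_add_of_nonneg_of_le (formTerm_nonneg _ _ _ _ _ _) ?_
    rw [abs_mul, abs_mul, mul_right_comm, formTerm]
    exact mul_le_mul_of_nonneg_left (abs_avg_le f Q) (by positivity)

lemma isParaproductTerm_piStarTerm (b : (Fin n → ℝ) → ℝ) :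
    IsParaproductTerm b (piStarTerm b) where
  congr Q f f' h := by
    funext x
    simp only [piStarTerm, haarCoeff_congr h]
  measurable Q f := Finset.measurable_sum _ fun ε _ =>
    ((measurable_const.indicator Q.measurableSet).div_const _).const_mul _
  bounded Q f := exists_indicator_bound_sum _ fun ε _ => by
    refine ⟨|haarCoeff b Q ε * haarCoeff f Q ε| * (1 / Q.vol),
      mul_nonneg (abs_nonneg _) (one_div_nonneg.2 Q.vol_pos.le), fun x => ?_⟩
    by_cases hx : x ∈ Q.toSet
    · simp [hx, abs_mul, abs_of_pos Q.vol_pos]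
    · simp [hx]
  pairing Q f g hf hg := by
    have hterm : ∀ a : ℝ, (fun x => a * (Q.toSet.indicator (fun _ => (1 : ℝ)) x / Q.vol) * g x) =
        Q.toSet.indicator fun x => a / Q.vol * g x := fun a => by
      funext x
      by_cases hx : x ∈ Q.toSet
      · rw [Set.indicator_of_mem hx, Set.indicator_of_mem hx]; ring
      · simp [hx]
    have hint : ∀ a : ℝ, ∫ x, a * (Q.toSet.indicator (fun _ => (1 : ℝ)) x / Q.vol) * g x =
        a * avg g Q := fun a => by
      rw [hterm, integral_indicator Q.measurableSet, integral_const_mul, avg_eq]; ring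
    simp only [piStarTerm, Finset.sum_mul]
    rw [integral_finsetSum _ fun ε _ => by
      rw [hterm, integrable_indicator_iff Q.measurableSet]
      exact (Q.integrableOn hg).const_mul _]
    simp only [hint]
    refine (Finset.abs_sum_le_sum_abs _ _).trans (le_trans (Finset.sum_le_sum fun ε _ => ?_)
      (sum_diag_le_sum_sum (a := fun ε θ => formTerm b f g ε θ Q + formTerm b g f ε θ Q)
        fun ε θ => add_nonneg (formTerm_nonneg _ _ _ _ _ _) (formTerm_nonneg _ _ _ _ _ _)))
    refine le_add_of_le_of_nonneg ?_ (formTerm_nonneg _ _ _ _ _ _)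
    rw [abs_mul, abs_mul, formTerm]
    exact mul_le_mul_of_nonneg_left (abs_avg_le g Q) (by positivity)

lemma isParaproductTerm_gammaTerm (b : (Fin n → ℝ) → ℝ) :
    IsParaproductTerm b (gammaTerm b) where
  congr Q f f' h := by
    funext x
    simp only [gammaTerm, haarCoeff_congr h]
  measurable Q f := Finset.measurable_sum _ fun ε _ => Finset.measurable_sum _ fun η _ =>
    ((measurable_haar Q _).const_mul _).const_mul _
  bounded Q f := exists_indicator_bound_sum _ fun ε _ => exists_indicator_bound_sum _ fun η _ => by
    simp only [← mul_assoc]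
    exact exists_indicator_bound_haar _ Q _
  pairing Q f g hf hg := by
    simp only [gammaTerm, Finset.sum_mul, ← mul_assoc (_ * _ : ℝ) (√Q.vol)⁻¹]
    rw [integral_finsetSum _ fun ε _ => integrable_finsetSum _ fun η _ =>
      integrable_mul_haar_mul _ hg Q _]
    refine (Finset.abs_sum_le_sum_abs _ _).trans (Finset.sum_le_sum fun ε _ => ?_)
    rw [integral_finsetSum _ fun η _ => integrable_mul_haar_mul _ hg Q _]
    simp only [integral_mul_haar_mul]
    refine (Finset.abs_sum_le_sum_abs _ _).trans ?_
    refine le_trans (Finset.sum_le_sum_of_subset_of_nonneg (Finset.filter_subset _ _)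
      fun _ _ _ => abs_nonneg _) (Finset.sum_le_sum fun η _ => ?_)
    refine le_add_of_le_of_nonneg ?_ (formTerm_nonneg _ _ _ _ _ _)
    rw [mul_assoc, abs_mul, abs_mul, formTerm, abs_mul (√Q.vol)⁻¹,
      abs_of_nonneg (a := (√Q.vol)⁻¹) (by positivity)]
    exact mul_le_mul_of_nonneg_left (sqrt_inv_mul_abs_haarCoeff_le hg Q _) (by positivity)

end Pairing

end Paraproducts

end Bloom

end

theorem theoremT (n : ℕ) (hn : 0 < n) (p : ℝ) (hp : 1 < p) :
    ∃ C : ℝ≥0, ∀ (D : Bloom.DyadicGrid n) (mu lam b : (Fin n → ℝ) → ℝ),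
      Bloom.IsApWeight D p mu → Bloom.IsApWeight D p lam →
      Bloom.MemBMO D (Bloom.bloomWeight p mu lam) b →
      Bloom.SeriesNormLE D p mu lam (Bloom.piTerm b)
          (C * Bloom.bmoNorm D (Bloom.bloomWeight p mu lam) b *
            Bloom.apChar D p mu ^ (1 / (p - 1)) * Bloom.apChar D p lam) ∧
      Bloom.SeriesNormLE D p mu lam (Bloom.piStarTerm b)
          (C * Bloom.bmoNorm D (Bloom.bloomWeight p mu lam) b *
            Bloom.apChar D p mu ^ (1 / (p - 1)) * Bloom.apChar D p lam) ∧
      Bloom.SeriesNormLE D p mu lam (Bloom.gammaTerm b)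
          (C * Bloom.bmoNorm D (Bloom.bloomWeight p mu lam) b *
            Bloom.apChar D p mu ^ (1 / (p - 1)) * Bloom.apChar D p lam) :=
  ⟨(Bloom.paraproductConst n p).toNNReal, fun _ _ _ b hmu hlam hb =>
    ⟨Bloom.seriesNormLE_of_isParaproductTerm hn hp hmu hlam hb (Bloom.isParaproductTerm_piTerm b),
      Bloom.seriesNormLE_of_isParaproductTerm hn hp hmu hlam hb
        (Bloom.isParaproductTerm_piStarTerm b),
      Bloom.seriesNormLE_of_isParaproductTerm hn hp hmu hlam hb
        (Bloom.isParaproductTerm_gammaTerm b)⟩⟩
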